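/- **Configuration systems.** A configuration system consists of a set $\mathbb U$, a finite indexed family $S$ of $n=|S|$ subsets of $\mathbb U$ (the objects), a finite set $\mathcal F$ of configurations, each having a region $y\subseteq\mathbb U$ and a defining set $B_y\subseteq S$, and a conflict relation between configurations and objects such that $s$ conflicts with $(y,B_y)$ whenever $s\cap y\neq\emptyset$. For $H\subseteq S$ let $\mathcal F_0(H)$ be the set of configurations with $B_y\subseteq H$ that conflict with no $s\in H$. The system is complete if for every $H\subseteq S$ each point of $\mathbb U\setminus\bigcup H$ lies in the region of some member of $\mathcal F_0(H)$. Fix $b$ and $D$; we consider complete systems in which $|B_y|\le b$ for every configuration and every subset of $S$ is the defining set of at most $D$ configurations. **Multisets and $f$.** For multiplicities $m:S\to\mathbb N$, the multiset $S_m$ with $m(s)$ copies of each $s$ carries the configuration system whose configurations are those of $\mathcal F$ together with a chosen copy of each defining object; a copy of $s$ conflicts if $s$ conflicts with $(y,B_y)$, or if $s\in B_y$ and the copy precedes the chosen copy of $s$. Let $f(r)$ be the supremum, over all $m$ with $|S_m|\ge r$, of $\mathbf E|\mathcal F_0(R)|$, where $R\subseteq S_m$ is a uniformly random subset of size $r$.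 An $\varepsilon$-net of $S_m$ is a subset of $S_m$ that covers every point of $\mathbb U$ lying in at least $\varepsilon|S_m|$ members of $S_m$. **Net finders.** For a real number $A$, an $A$-net finder is a subroutine that, given $m$ and $r$ with $\max(1,2b)\le r\le |S_m|$, returns a $1/r$-net of $S_m$ with at most $A\max(1,f(r))$ elements; its answers and its running time may vary from call to call. **Theorem.** (i) There is a constant $A$, depending only on $b$ and $D$, such that every such system has an $A$-net finder, i.e. such nets exist for all these $m$ and $r$. (ii) There is a program $P$ (for a random access machine with unit-cost addition, truncated subtraction, indirect addressing, conditionals, loops, and calls of a net finder), depending only on $b$, and for all $D$ and $A$ there are constants $K$, $Q$ and a polynomial $q$, depending only on $b,D,A$, such that the following holds for every such system, every $\mathbb M\subseteq\mathbb U$ and every $A$-net finder. The input of $P$ is $n$ and the list, without repetition, of the incidence vectors $(\mathbf 1[p\in s])_{s\in S}$ of the points $p\in\mathbb M$. If $\mathbb M$ is covered by some $c$ objects of $S$ (the number $c$ is not part of the input), then $P$ halts and outputs a subfamily of $S$ that covers $\mathbb M$ and has at most $K\max(1,f(c))$ members. Its running time, the time spent in the net finder included, is at most $(T+1)\,q(n)$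 for every $T$ that bounds the time of each call of the net finder with $\max(1,2b)\le r\le Qc$ and $r\le|S_m|\le q(n)$. -/

import Mathlib

universe u v w

namespace GeomCover

/-- A configuration system with ground set `U` and objects `obj s`, `s : ι`.
An element `y : Region` is a configuration `(y, B_y)`: its point set is `carrier y`, the set of
objects that defines it is `defs y`, and `Conflict y s` says that `s` conflicts with it. -/
structure ConfigSystem (U : Type u) (ι : Type v) where
  obj : ι → Set U
  Region : Type w
  finite_region : Finite Region
  carrier : Region → Set U
  defs : Region → Finset ι
  Conflict : Region → ι → Prop
  conflict_of_meets : ∀ y s, (carrier y ∩ obj s).Nonempty → Conflict y s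

namespace ConfigSystem

variable {U : Type u} {ι : Type v}

/-- The `0`-regions of `H`: defined by objects of `H`, in conflict with no object of `H`. -/
def zeroRegions (C : ConfigSystem.{u, v, w} U ι) (H : Finset ι) : Set C.Region :=
  {y | C.defs y ⊆ H ∧ ∀ s ∈ H, ¬ C.Conflict y s}

/-- Every point outside the union of `H` lies in some `0`-region of `H`. -/
def IsComplete (C : ConfigSystem.{u, v, w} U ι) : Prop :=
  ∀ (H : Finset ι) (p : U), (∀ s ∈ H, p ∉ C.obj s) → ∃ y ∈ C.zeroRegions H, p ∈ C.carrier y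

/-- Every configuration is defined by at most `b` objects. -/
def DefinedByAtMost (C : ConfigSystem.{u, v, w} U ι) (b : ℕ) : Prop :=
  ∀ y, (C.defs y).card ≤ b

/-- Every set of objects defines at most `D` configurations. -/
def DefinesAtMost (C : ConfigSystem.{u, v, w} U ι) (D : ℕ) : Prop :=
  ∀ B : Finset ι, {y | C.defs y = B}.ncard ≤ D

/-- `H` covers `M`. -/
def IsCover (C : ConfigSystem.{u, v, w} U ι) (M : Set U) (H : Finset ι) : Prop :=
  ∀ p ∈ M, ∃ s ∈ H, p ∈ C.obj s

/-- `N` is an `ε`-net: it covers every point that lies in at least `ε |S|` objects. -/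
def IsNet [Fintype ι] (C : ConfigSystem.{u, v, w} U ι) (ε : ℝ) (N : Finset ι) : Prop :=
  ∀ p : U, ε * (Fintype.card ι : ℝ) ≤ ({s | p ∈ C.obj s}.ncard : ℝ) → ∃ s ∈ N, p ∈ C.obj s

/-- `E |F₀(R)|` for a uniformly random `R` of size `r` (meaningful for `r ≤ |S|`). -/
noncomputable def expZeroRegions [Fintype ι] (C : ConfigSystem.{u, v, w} U ι) (r : ℕ) : ℝ :=
  (∑ R ∈ (Finset.univ : Finset ι).powersetCard r, ((C.zeroRegions R).ncard : ℝ)) /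
    ((Fintype.card ι).choose r : ℝ)

/-- The elements of the multiset that has `m s` copies of each `s`. -/
abbrev Copy (m : ι → ℕ) : Type v := Σ s : ι, Fin (m s)

/-- The configuration system of the multiset with `m s` copies of each object `s`.
A configuration is one of `C` with a chosen copy of each of its defining objects. Ties between
copies are broken by index: a copy of a defining object that precedes the chosen one conflicts. -/
def copies (C : ConfigSystem.{u, v, w} U ι) (m : ι → ℕ) :
    ConfigSystem.{u, v, max v w} U (Copy m) where
  obj s := C.obj s.1
  Region := Σ y : C.Region, ((s : {s // s ∈ C.defs y}) → Fin (m s.1))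
  finite_region := by
    have := C.finite_region
    infer_instance
  carrier y := C.carrier y.1
  defs y := (C.defs y.1).attach.map
    ⟨fun s => ⟨s.1, y.2 s⟩, fun _ _ h => Subtype.ext (congrArg Sigma.fst h)⟩
  Conflict y s := C.Conflict y.1 s.1 ∨ ∃ h : s.1 ∈ C.defs y.1, s.2 < y.2 ⟨s.1, h⟩
  conflict_of_meets y s h := Or.inl (C.conflict_of_meets y.1 s.1 h)

/-- `f(r)`: the largest value of `E |F₀(R)|`, for a random `R` of size `r`, over all
multisets of at least `r` objects of `S`. (The values are at most `|Region|`.) -/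
noncomputable def f [Fintype ι] (C : ConfigSystem.{u, v, w} U ι) (r : ℕ) : ℝ :=
  ⨆ m : {m : ι → ℕ // r ≤ ∑ s, m s}, (C.copies m.1).expZeroRegions r

/-- `pts` lists without repetition the sets `{s | p ∈ s}` of the points `p ∈ M`. -/
def Lists {n : ℕ} (C : ConfigSystem.{u, 0, w} U (Fin n)) (M : Set U)
    (pts : List (Finset (Fin n))) : Prop :=
  pts.Nodup ∧ ∀ t, t ∈ pts ↔ ∃ p ∈ M, ∀ s, s ∈ t ↔ p ∈ C.obj s

end ConfigSystem

/-- A subroutine that builds nets. The `j`-th call, with multiplicities `m` and parameter `r`,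
where `max 1 (2 b) ≤ r ≤ |S'|`, returns a `1/r`-net of the multiset `S'` given by `m`, with at
most `A · max (1, f r)` elements, in time `cost j m r`. The answers may depend on `j`,
so that they may be outcomes of a randomized construction. -/
structure NetFinder {U : Type u} {n : ℕ} (C : ConfigSystem.{u, 0, w} U (Fin n))
    (b : ℕ) (A : ℝ) where
  find : ℕ → (m : Fin n → ℕ) → ℕ → Finset (ConfigSystem.Copy m)
  cost : ℕ → (Fin n → ℕ) → ℕ → ℕ
  isNet : ∀ j m r, 1 ≤ r → 2 * b ≤ r → r ≤ ∑ s, m s →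
    (C.copies m).IsNet (1 / (r : ℝ)) (find j m r)
  card_le : ∀ j m r, 1 ≤ r → 2 * b ≤ r → r ≤ ∑ s, m s →
    ((find j m r).card : ℝ) ≤ A * max 1 (C.f r)

/-- Structured programs for a random access machine with addition and truncated subtraction
(no multiplication), indirect addressing, and calls of a net-building subroutine. -/
inductive Com : Type
  | const (x k : ℕ)
  | add (x y z : ℕ)
  | sub (x y z : ℕ)
  | load (x y : ℕ)
  | store (x y : ℕ)
  | net (x y z : ℕ)
  | seq (p q : Com)
  | ifnz (x : ℕ) (p q : Com)
  | whilenz (x : ℕ) (p : Com)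

/-- Registers, memory, and the number of subroutine calls made so far. -/
structure Store : Type where
  reg : ℕ → ℕ
  mem : ℕ → ℕ
  calls : ℕ

namespace Store

def setReg (σ : Store) (x k : ℕ) : Store := { σ with reg := Function.update σ.reg x k }

def setMem (σ : Store) (a k : ℕ) : Store := { σ with mem := Function.update σ.mem a k }

/-- The multiplicities stored in the `n` cells from address `a` on. -/
def readMult (n : ℕ) (σ : Store) (a : ℕ) : Fin n → ℕ := fun s => σ.mem (a + s)

/-- Write the indicator vector of `N` to the `n` cells from address `a` on. -/
def writeSet {n : ℕ} (σ : Store) (a : ℕ) (N : Finset (Fin n)) : Store :=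
  { σ with
    mem := fun i =>
      if h : a ≤ i ∧ i - a < n then
        (if (⟨i - a, h.2⟩ : Fin n) ∈ N then 1 else 0)
      else σ.mem i
    calls := σ.calls + 1 }

/-- The set whose indicator vector is stored in the `n` cells from address `a` on. -/
def readSet (n : ℕ) (σ : Store) (a : ℕ) : Finset (Fin n) :=
  Finset.univ.filter fun s => σ.mem (a + s) ≠ 0

/-- The input: `n` and the number of points in registers `0` and `1`, and the incidence matrix of
points and objects in memory, row by row. -/
def input {n : ℕ} (pts : List (Finset (Fin n))) : Store where
  reg x := if x = 0 then n else if x = 1 then pts.length else 0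
  mem i :=
    if ∃ (j : Fin pts.length) (s : Fin n), i = j * n + s ∧ s ∈ pts.get j then 1 else 0
  calls := 0

/-- The output: the set stored at the address in register `2`. -/
def output (n : ℕ) (σ : Store) : Finset (Fin n) := σ.readSet n (σ.reg 2)

end Store

open Classical in
/-- `Exec F p σ σ' t`: from `σ`, the program `p` with net subroutine `F` halts in `σ'` in
time `t`. An elementary step takes time `1`; a call takes time `n + 1` for passing
the arguments, plus the time of the subroutine. -/
inductive Exec {U : Type u} {n : ℕ} {C : ConfigSystem.{u, 0, w} U (Fin n)} {b : ℕ} {A : ℝ}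
    (F : NetFinder C b A) : Com → Store → Store → ℕ → Prop
  | const (x k : ℕ) (σ : Store) : Exec F (.const x k) σ (σ.setReg x k) 1
  | add (x y z : ℕ) (σ : Store) :
      Exec F (.add x y z) σ (σ.setReg x (σ.reg y + σ.reg z)) 1
  | sub (x y z : ℕ) (σ : Store) :
      Exec F (.sub x y z) σ (σ.setReg x (σ.reg y - σ.reg z)) 1
  | load (x y : ℕ) (σ : Store) :
      Exec F (.load x y) σ (σ.setReg x (σ.mem (σ.reg y))) 1
  | store (x y : ℕ) (σ : Store) :
      Exec F (.store x y) σ (σ.setMem (σ.reg x) (σ.reg y)) 1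
  | net (x y z : ℕ) (σ : Store) :
      Exec F (.net x y z) σ
        (σ.writeSet (σ.reg z)
          ((F.find σ.calls (σ.readMult n (σ.reg x)) (σ.reg y)).image Sigma.fst))
        (F.cost σ.calls (σ.readMult n (σ.reg x)) (σ.reg y) + n + 1)
  | seq {p q : Com} {σ σ' σ'' : Store} {t t' : ℕ} :
      Exec F p σ σ' t → Exec F q σ' σ'' t' → Exec F (.seq p q) σ σ'' (t + t')
  | if_pos {x : ℕ} {p q : Com} {σ σ' : Store} {t : ℕ} :
      σ.reg x ≠ 0 → Exec F p σ σ' t → Exec F (.ifnz x p q) σ σ' (t + 1)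
  | if_neg {x : ℕ} {p q : Com} {σ σ' : Store} {t : ℕ} :
      σ.reg x = 0 → Exec F q σ σ' t → Exec F (.ifnz x p q) σ σ' (t + 1)
  | while_neg {x : ℕ} {p : Com} {σ : Store} :
      σ.reg x = 0 → Exec F (.whilenz x p) σ σ 1
  | while_pos {x : ℕ} {p : Com} {σ σ' σ'' : Store} {t t' : ℕ} :
      σ.reg x ≠ 0 → Exec F p σ σ' t → Exec F (.whilenz x p) σ' σ'' t' →
      Exec F (.whilenz x p) σ σ'' (t + t' + 1)

end GeomCover

/-!
**Nets.** Draw `b + 1` independent blocks of elements. A defining set with at most `b` elements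
misses one of the blocks, so every configuration that survives the whole sample survives the other
`b` blocks, of which there are `O(f r)`, and independently the missed block, which is exponentially
unlikely if it has many conflicts. Hence the conflicts with the survivors can be afforded: adding to
some sample a net of the conflict set of each survivor gives a net with `O(r + f r)` elements. In
a minimal net every element has a private point. If the element is outside a sample, this point lies
in a survivor, which conflicts with the element; so at most `r` such elements number only `O(f r)`.

**Covers.** Guess the size `c` of a cover and start with equal weights. Compute a `1 / r`-net with
`r = O(c)`; if it misses a point, double the weights of the objects that contain the point. The
total weight grows by at most the factor `1 + 1 / r`, whereas some element of the cover is doubled.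
These two rates are compatible only while the total weight is at most quadratic in `n`, unless the
guess is too small, in which case it is increased. The nets have size `O(f (Q * c))`, which is
`O(f c)`: split a set of `Q * c` objects into a bounded number of small parts, of which the defining
set of a configuration meets at most `b`.
-/

namespace GeomCover

theorem card_filter_powerset_card_le {α : Type*} (H : Finset α) (b : ℕ) :
    (H.powerset.filter fun B => B.card ≤ b).card ≤ (H.card + 1) ^ b := by
  classical
  induction b with
  | zero => exact Finset.card_le_one.mpr fun B hB B' hB' => by simp_all
  | succ b ih =>
    have hsub : H.powerset.filter (fun B => B.card ≤ b + 1) ⊆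
        (H.insertNone ×ˢ H.powerset.filter fun B => B.card ≤ b).image
          fun x => x.1.elim x.2 (insert · x.2) := by
      intro B hB
      obtain ⟨hBH, hcard⟩ := Finset.mem_filter.mp hB
      rw [Finset.mem_powerset] at hBH
      rcases B.eq_empty_or_nonempty with rfl | ⟨s, hs⟩
      · exact Finset.mem_image.mpr ⟨(none, ∅), by simp, rfl⟩
      · refine Finset.mem_image.mpr ⟨(some s, B.erase s), ?_, Finset.insert_erase hs⟩
        have herase := Finset.card_erase_of_mem hs
        simp only [Finset.mem_product, Finset.some_mem_insertNone, Finset.mem_filter,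
          Finset.mem_powerset]
        exact ⟨hBH hs, (Finset.erase_subset s B).trans hBH, by omega⟩
    calc _ ≤ (H.card + 1) * (H.powerset.filter fun B => B.card ≤ b).card := by
          refine (Finset.card_le_card hsub).trans (Finset.card_image_le.trans_eq ?_)
          rw [Finset.card_product, Finset.card_insertNone]
      _ ≤ (H.card + 1) ^ (b + 1) := by
          rw [pow_succ']
          exact Nat.mul_le_mul_left _ ih

theorem exists_balanced_coloring {α : Type*} {H : Finset α} {k q : ℕ} (hH : H.card ≤ k * q) :
    ∃ color : H → Fin k, ∀ i, (Finset.univ.filter fun s => color s = i).card ≤ q := by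
  obtain ⟨e⟩ : Nonempty (H ↪ Fin k × Fin q) :=
    Function.Embedding.nonempty_of_card_le (by simpa using hH)
  refine ⟨fun s => (e s).1, fun i => ?_⟩
  calc _ ≤ (Finset.univ : Finset (Fin q)).card := by
        refine Finset.card_le_card_of_injOn (fun s => (e s).2) (fun _ _ => Finset.mem_univ _) ?_
        intro s hs s' hs' h
        simp only [Finset.coe_filter, Finset.mem_univ, true_and, Set.mem_ofPred_eq] at hs hs'
        exact e.injective (Prod.ext (hs.trans hs'.symm) h)
    _ = q := by simp

namespace ConfigSystem

variable {U : Type u} {ι : Type v} {C : ConfigSystem.{u, v, w} U ι} {b D : ℕ}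

instance (C : ConfigSystem.{u, v, w} U ι) : Finite C.Region := C.finite_region

/-- The `0`-regions of `H`, as a finite set. -/
noncomputable def zeroFinset (C : ConfigSystem.{u, v, w} U ι) (H : Finset ι) : Finset C.Region :=
  (Set.toFinite (C.zeroRegions H)).toFinset

theorem mem_zeroFinset {H : Finset ι} {y : C.Region} :
    y ∈ C.zeroFinset H ↔ C.defs y ⊆ H ∧ ∀ s ∈ H, ¬ C.Conflict y s := by
  simp [zeroFinset, zeroRegions]

theorem ncard_zeroRegions (C : ConfigSystem.{u, v, w} U ι) (H : Finset ι) :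
    (C.zeroRegions H).ncard = (C.zeroFinset H).card :=
  Set.ncard_eq_toFinset_card _ _

theorem mem_zeroFinset_of_subset {H H' : Finset ι} (hH : H' ⊆ H) {y : C.Region}
    (hy : y ∈ C.zeroFinset H) (hdefs : C.defs y ⊆ H') : y ∈ C.zeroFinset H' :=
  mem_zeroFinset.mpr ⟨hdefs, fun s hs => (mem_zeroFinset.mp hy).2 s (hH hs)⟩

theorem ncard_defs_subset_le (hb : C.DefinedByAtMost b) (hD : C.DefinesAtMost D)
    (H : Finset ι) : {y | C.defs y ⊆ H}.ncard ≤ D * (H.card + 1) ^ b := by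
  classical
  have hsub : {y | C.defs y ⊆ H} ⊆
      ⋃ B ∈ H.powerset.filter fun B => B.card ≤ b, {y | C.defs y = B} := fun y hy =>
    Set.mem_biUnion (x := C.defs y)
      (Finset.mem_filter.mpr ⟨Finset.mem_powerset.mpr hy, hb y⟩) rfl
  calc _ ≤ ∑ B ∈ H.powerset.filter fun B => B.card ≤ b, {y | C.defs y = B}.ncard :=
        (Set.ncard_le_ncard hsub (Set.toFinite _)).trans (Finset.set_ncard_biUnion_le _ _)
    _ ≤ (H.powerset.filter fun B => B.card ≤ b).card * D :=
        Finset.sum_le_card_nsmul _ _ D fun B _ => hD B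
    _ ≤ D * (H.card + 1) ^ b := by
        rw [mul_comm]
        exact Nat.mul_le_mul_left D (card_filter_powerset_card_le H b)

theorem card_zeroFinset_le (hb : C.DefinedByAtMost b) (hD : C.DefinesAtMost D) (H : Finset ι) :
    (C.zeroFinset H).card ≤ D * (H.card + 1) ^ b := by
  rw [← ncard_zeroRegions]
  exact (Set.ncard_le_ncard (fun y hy => hy.1) (Set.toFinite _)).trans
    (ncard_defs_subset_le hb hD H)

theorem card_zeroFinset_empty_le (hD : C.DefinesAtMost D) : (C.zeroFinset ∅).card ≤ D := by
  rw [← ncard_zeroRegions]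
  exact (Set.ncard_le_ncard (fun y hy => Finset.subset_empty.mp hy.1) (Set.toFinite _)).trans
    (hD ∅)

theorem IsComplete.exists_forall_conflict_iff [Finite ι] (hC : C.IsComplete) (p : U) :
    ∃ y, ∀ s, C.Conflict y s ↔ p ∈ C.obj s := by
  obtain ⟨y, hy, hpy⟩ := hC (Set.toFinite {s | p ∉ C.obj s}).toFinset p (by simp)
  refine ⟨y, fun s => ⟨fun h => ?_, fun hs => C.conflict_of_meets y s ⟨p, hpy, hs⟩⟩⟩
  by_contra hs
  exact hy.2 s (by simpa using hs) h

theorem Lists.length_le {n : ℕ} {C : ConfigSystem.{u, 0, w} U (Fin n)} (hC : C.IsComplete)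
    (hb : C.DefinedByAtMost b) (hD : C.DefinesAtMost D) {M : Set U}
    {pts : List (Finset (Fin n))} (hpts : C.Lists M pts) :
    pts.length ≤ D * (n + 1) ^ b := by
  classical
  have hsub : (pts.toFinset : Set (Finset (Fin n))) ⊆
      (fun y => Finset.univ.filter (C.Conflict y)) '' Set.univ := by
    intro t ht
    obtain ⟨p, _, hp⟩ := (hpts.2 t).mp (List.mem_toFinset.mp ht)
    obtain ⟨y, hy⟩ := hC.exists_forall_conflict_iff p
    exact ⟨y, trivial, by ext s; simp [hy, hp]⟩
  have hregions := ncard_defs_subset_le hb hD Finset.univ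
  simp only [Finset.subset_univ, Set.ofPred_true, Finset.card_univ, Fintype.card_fin] at hregions
  calc pts.length = (pts.toFinset : Set (Finset (Fin n))).ncard := by
        rw [Set.ncard_coe_finset, List.toFinset_card_of_nodup hpts.1]
    _ ≤ (Set.univ : Set C.Region).ncard :=
        (Set.ncard_le_ncard hsub (Set.toFinite _)).trans (Set.ncard_image_le Set.finite_univ)
    _ ≤ D * (n + 1) ^ b := hregions

/-- The largest number of `0`-regions of a set of at most `r` objects: the version of `f` without
multiplicities and without expectation. The two agree up to constants. -/
noncomputable def maxZeroRegions (C : ConfigSystem.{u, v, w} U ι) (r : ℕ) : ℕ :=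
  ⨆ H : {H : Finset ι // H.card ≤ r}, (C.zeroFinset H.1).card

theorem card_zeroFinset_le_maxZeroRegions {r : ℕ} {H : Finset ι} (hH : H.card ≤ r) :
    (C.zeroFinset H).card ≤ C.maxZeroRegions r := by
  have hbdd : BddAbove (Set.range fun H : {H : Finset ι // H.card ≤ r} =>
      (C.zeroFinset H.1).card) :=
    ⟨Nat.card C.Region, by
      rintro _ ⟨H, rfl⟩
      exact (C.ncard_zeroRegions H.1).symm.trans_le (Set.ncard_le_card _)⟩
  exact le_ciSup hbdd ⟨H, hH⟩

theorem maxZeroRegions_le {r B : ℕ} (h : ∀ H : Finset ι, H.card ≤ r → (C.zeroFinset H).card ≤ B) :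
    C.maxZeroRegions r ≤ B :=
  have : Nonempty {H : Finset ι // H.card ≤ r} := ⟨⟨∅, by simp⟩⟩
  ciSup_le fun H => h H.1 H.2

theorem maxZeroRegions_mono : Monotone C.maxZeroRegions := fun _ _ h =>
  maxZeroRegions_le fun _ hH => card_zeroFinset_le_maxZeroRegions (hH.trans h)

theorem maxZeroRegions_le_pow (hb : C.DefinedByAtMost b) (hD : C.DefinesAtMost D) (r : ℕ) :
    C.maxZeroRegions r ≤ D * (r + 1) ^ b :=
  maxZeroRegions_le fun H hH => (card_zeroFinset_le hb hD H).trans (by gcongr)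

theorem maxZeroRegions_mul_le (hb : C.DefinedByAtMost b) (k q : ℕ) :
    C.maxZeroRegions (k * q) ≤ 2 ^ k * C.maxZeroRegions (q * b) := by
  classical
  refine maxZeroRegions_le fun H hH => ?_
  obtain ⟨color, hcolor⟩ := exists_balanced_coloring hH
  let part (W : Finset (Fin k)) : Finset ι :=
    (Finset.univ.filter fun s => color s ∈ W).map (Function.Embedding.subtype _)
  have hpart (W : Finset (Fin k)) : (part W).card ≤ q * W.card := by
    rw [Finset.card_map]
    refine Finset.card_le_mul_card_image_of_maps_to
      (fun s hs => (Finset.mem_filter.mp hs).2) q fun i _ => ?_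
    exact (Finset.card_le_card (Finset.filter_subset_filter _ (Finset.filter_subset _ _))).trans
      (hcolor i)
  have hsubset (W : Finset (Fin k)) : part W ⊆ H := fun s hs => by
    obtain ⟨s, _, rfl⟩ := Finset.mem_map.mp hs
    exact s.2
  -- A `0`-region of `H` is one of the union of the at most `b` parts that meet its defining set.
  have hcover : C.zeroFinset H ⊆
      (Finset.univ.filter fun W : Finset (Fin k) => W.card ≤ b).biUnion
        fun W => C.zeroFinset (part W) := by
    intro y hy
    have hdefs := (mem_zeroFinset.mp hy).1
    refine Finset.mem_biUnion.mpr ⟨((C.defs y).subtype (· ∈ H)).image color, ?_,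
      mem_zeroFinset_of_subset (hsubset _) hy fun s hs => ?_⟩
    · have hcard : ((C.defs y).subtype (· ∈ H)).card ≤ (C.defs y).card := by
        rw [Finset.card_subtype]
        exact Finset.card_filter_le _ _
      exact Finset.mem_filter.mpr
        ⟨Finset.mem_univ _, Finset.card_image_le.trans (hcard.trans (hb y))⟩
    · exact Finset.mem_map.mpr ⟨⟨s, hdefs hs⟩, Finset.mem_filter.mpr ⟨Finset.mem_univ _,
        Finset.mem_image_of_mem _ (Finset.mem_subtype.mpr hs)⟩, rfl⟩
  calc (C.zeroFinset H).card
      ≤ (Finset.univ.filter fun W : Finset (Fin k) => W.card ≤ b).card *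
          C.maxZeroRegions (q * b) :=
        (Finset.card_le_card hcover).trans (Finset.card_biUnion_le_card_mul _ _ _ fun W hW =>
          card_zeroFinset_le_maxZeroRegions ((hpart W).trans
            (Nat.mul_le_mul_left q (Finset.mem_filter.mp hW).2)))
    _ ≤ 2 ^ k * C.maxZeroRegions (q * b) := by
        gcongr
        exact (Finset.card_filter_le _ _).trans (by simp)

theorem maxZeroRegions_mul_le_add (hb : C.DefinedByAtMost b) (hD : C.DefinesAtMost D)
    (Q c : ℕ) : C.maxZeroRegions (Q * c) ≤
      D * (Q * b + 1) ^ b + 2 ^ (2 * (b + 1) * Q) * C.maxZeroRegions c := by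
  rcases le_or_gt c b with hcb | hbc
  · calc C.maxZeroRegions (Q * c) ≤ D * (Q * c + 1) ^ b := maxZeroRegions_le_pow hb hD _
      _ ≤ D * (Q * b + 1) ^ b := by gcongr
      _ ≤ _ := Nat.le_add_right _ _
  · set q := c / (b + 1)
    have hlow : q * b ≤ c :=
      (Nat.mul_le_mul_left q b.le_succ).trans (Nat.div_mul_le_self c (b + 1))
    have hhigh : Q * c ≤ 2 * (b + 1) * Q * q := by
      have hq : 0 < q := Nat.div_pos hbc b.succ_pos
      have hc : c < (b + 1) * (q + 1) := Nat.lt_mul_div_succ c b.succ_pos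
      calc Q * c ≤ Q * ((b + 1) * (q + q)) := by gcongr; nlinarith
        _ = 2 * (b + 1) * Q * q := by ring
    calc C.maxZeroRegions (Q * c) ≤ C.maxZeroRegions (2 * (b + 1) * Q * q) :=
          maxZeroRegions_mono hhigh
      _ ≤ 2 ^ (2 * (b + 1) * Q) * C.maxZeroRegions (q * b) := maxZeroRegions_mul_le hb _ _
      _ ≤ 2 ^ (2 * (b + 1) * Q) * C.maxZeroRegions c := by
          gcongr
          exact maxZeroRegions_mono hlow
      _ ≤ _ := Nat.le_add_left _ _

theorem mem_zeroRegions_copies [DecidableEq ι] {m : ι → ℕ} {R : Finset (Copy m)}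
    {y : (C.copies m).Region} (hy : y ∈ (C.copies m).zeroRegions R) :
    y.1 ∈ C.zeroFinset (R.image Sigma.fst) ∧ ∀ s, (⟨s.1, y.2 s⟩ : Copy m) ∈ R := by
  have hmem : ∀ s, (⟨s.1, y.2 s⟩ : Copy m) ∈ R := fun s =>
    hy.1 (Finset.mem_map.mpr ⟨s, Finset.mem_attach _ _, rfl⟩)
  refine ⟨mem_zeroFinset.mpr ⟨fun s hs => ?_, fun s hs h => ?_⟩, hmem⟩
  · exact Finset.mem_image.mpr ⟨_, hmem ⟨s, hs⟩, rfl⟩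
  · obtain ⟨a, ha, rfl⟩ := Finset.mem_image.mp hs
    exact hy.2 a ha (Or.inl h)

theorem ncard_zeroRegions_copies_le [DecidableEq ι] (C : ConfigSystem.{u, v, w} U ι) (m : ι → ℕ)
    (R : Finset (Copy m)) :
    ((C.copies m).zeroRegions R).ncard ≤ (C.zeroFinset (R.image Sigma.fst)).card := by
  rw [← Set.ncard_coe_finset]
  refine Set.ncard_le_ncard_of_injOn Sigma.fst
    (fun y hy => (mem_zeroRegions_copies hy).1) ?_ (Finset.finite_toSet _)
  rintro ⟨y, a⟩ hy ⟨y', a'⟩ hy' (rfl : y = y')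
  have ha := (mem_zeroRegions_copies hy).2
  have ha' := (mem_zeroRegions_copies hy').2
  congr 1
  funext s
  refine le_antisymm (not_lt.mp fun h => ?_) (not_lt.mp fun h => ?_)
  · exact hy.2 _ (ha' s) (Or.inr ⟨s.2, h⟩)
  · exact hy'.2 _ (ha s) (Or.inr ⟨s.2, h⟩)

variable [Fintype ι]

theorem expZeroRegions_copies_le (C : ConfigSystem.{u, v, w} U ι) (m : ι → ℕ) (r : ℕ) :
    (C.copies m).expZeroRegions r ≤ C.maxZeroRegions r := by
  classical
  refine div_le_of_le_mul₀ (Nat.cast_nonneg _) (Nat.cast_nonneg _) ?_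
  refine (Finset.sum_le_card_nsmul _ _ (C.maxZeroRegions r : ℝ) fun R hR => ?_).trans_eq ?_
  · exact Nat.cast_le.mpr ((ncard_zeroRegions_copies_le C m R).trans
      (card_zeroFinset_le_maxZeroRegions
        (Finset.card_image_le.trans_eq (Finset.mem_powersetCard.mp hR).2)))
  · rw [Finset.card_powersetCard, nsmul_eq_mul, mul_comm, Finset.card_univ]

theorem f_le_maxZeroRegions (C : ConfigSystem.{u, v, w} U ι) (r : ℕ) :
    C.f r ≤ C.maxZeroRegions r :=
  Real.iSup_le (fun m => C.expZeroRegions_copies_le m.1 r) (Nat.cast_nonneg _)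

theorem expZeroRegions_copies_le_f (C : ConfigSystem.{u, v, w} U ι) {m : ι → ℕ} {r : ℕ}
    (hm : r ≤ ∑ s, m s) : (C.copies m).expZeroRegions r ≤ C.f r := by
  have hbdd : BddAbove (Set.range fun m : {m : ι → ℕ // r ≤ ∑ s, m s} =>
      (C.copies m.1).expZeroRegions r) :=
    ⟨C.maxZeroRegions r, by rintro _ ⟨m, rfl⟩; exact C.expZeroRegions_copies_le m.1 r⟩
  exact le_ciSup hbdd ⟨m, hm⟩

theorem expZeroRegions_card (C : ConfigSystem.{u, v, w} U ι) :
    C.expZeroRegions (Fintype.card ι) = (C.zeroRegions Finset.univ).ncard := by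
  rw [expZeroRegions, ← Finset.card_univ, Finset.powersetCard_self]
  simp

theorem card_zeroFinset_le_ncard_zeroRegions_copies_univ {m : ι → ℕ} {H : Finset ι}
    (hm : ∀ s, 0 < m s ↔ s ∈ H) :
    (C.zeroFinset H).card ≤ ((C.copies m).zeroRegions Finset.univ).ncard := by
  rw [← ncard_zeroRegions]
  refine le_trans (Set.ncard_le_ncard (fun y hy => ?_) (Set.toFinite _))
    (Set.ncard_image_le (f := Sigma.fst) (Set.toFinite _))
  refine ⟨⟨y, fun s => ⟨0, (hm s).mpr (hy.1 s.2)⟩⟩,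
    ⟨Finset.subset_univ _, fun a _ => ?_⟩, rfl⟩
  rintro (h | ⟨_, h⟩)
  · exact hy.2 _ ((hm a.1).mp a.2.pos) h
  · exact absurd h (Nat.not_lt_zero _)

theorem exists_pos_iff_mem_sum_eq {H : Finset ι} (hH : H.Nonempty) {r : ℕ} (hr : H.card ≤ r) :
    ∃ m : ι → ℕ, (∀ s, 0 < m s ↔ s ∈ H) ∧ ∑ s, m s = r := by
  classical
  obtain ⟨s₀, hs₀⟩ := hH
  refine ⟨fun s => (if s ∈ H then 1 else 0) + if s = s₀ then r - H.card else 0, fun s => ?_, ?_⟩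
  · by_cases hs : s ∈ H
    · simp [hs]
    · have hne : s ≠ s₀ := fun h => hs (h ▸ hs₀)
      simp [hs, hne]
  · simp only [Finset.sum_add_distrib, Finset.sum_ite_mem, Finset.univ_inter,
      Finset.sum_const, smul_eq_mul, mul_one, Finset.sum_ite_eq', Finset.mem_univ, if_true]
    omega

theorem card_zeroFinset_le_f {r : ℕ} {H : Finset ι} (hH : H.Nonempty) (hr : H.card ≤ r) :
    ((C.zeroFinset H).card : ℝ) ≤ C.f r := by
  obtain ⟨m, hpos, hsum⟩ := exists_pos_iff_mem_sum_eq hH hr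
  have hcard : Fintype.card (Copy m) = r := by simp [hsum]
  calc ((C.zeroFinset H).card : ℝ)
      ≤ ((C.copies m).zeroRegions Finset.univ).ncard :=
        Nat.cast_le.mpr (card_zeroFinset_le_ncard_zeroRegions_copies_univ hpos)
    _ = (C.copies m).expZeroRegions r := by rw [← hcard, expZeroRegions_card]
    _ ≤ C.f r := C.expZeroRegions_copies_le_f hsum.ge

theorem maxZeroRegions_le_mul_f (hD : C.DefinesAtMost D) (r : ℕ) :
    (C.maxZeroRegions r : ℝ) ≤ (D + 1) * max 1 (C.f r) := by
  have hf : 1 ≤ max 1 (C.f r) := le_max_left _ _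
  have hD1 : (1 : ℝ) ≤ D + 1 := by simp
  refine (Nat.cast_le.mpr (maxZeroRegions_le fun H hH =>
    Nat.le_floor ?_)).trans (Nat.floor_le (by positivity))
  rcases H.eq_empty_or_nonempty with rfl | hne
  · calc ((C.zeroFinset ∅).card : ℝ) ≤ D + 1 := by
          exact_mod_cast (card_zeroFinset_empty_le hD).trans D.le_succ
      _ ≤ (D + 1) * max 1 (C.f r) := le_mul_of_one_le_right (by positivity) hf
  · calc ((C.zeroFinset H).card : ℝ) ≤ max 1 (C.f r) :=
          (card_zeroFinset_le_f hne hH).trans (le_max_right _ _)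
      _ ≤ (D + 1) * max 1 (C.f r) := le_mul_of_one_le_left (by positivity) hD1

/-- The factor by which `max 1 f` grows at most when its argument is multiplied by `Q`. -/
def growthFactor (b D Q : ℕ) : ℕ :=
  1 + D * (Q * b + 1) ^ b + 2 ^ (2 * (b + 1) * Q) * (D + 1)

theorem max_one_f_le_mul (hb : C.DefinedByAtMost b) (hD : C.DefinesAtMost D) {Q c r : ℕ}
    (hr : r ≤ Q * c) : max 1 (C.f r) ≤ growthFactor b D Q * max 1 (C.f c) := by
  have hf : 1 ≤ max 1 (C.f c) := le_max_left _ _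
  have hmax : (C.maxZeroRegions r : ℝ) ≤
      D * (Q * b + 1) ^ b + 2 ^ (2 * (b + 1) * Q) * C.maxZeroRegions c := by
    exact_mod_cast (maxZeroRegions_mono hr).trans (maxZeroRegions_mul_le_add hb hD Q c)
  calc max 1 (C.f r) ≤ 1 + C.maxZeroRegions r :=
        max_le (by simp) ((C.f_le_maxZeroRegions r).trans (by simp))
    _ ≤ (1 + D * (Q * b + 1) ^ b) * 1 +
          2 ^ (2 * (b + 1) * Q) * ((D + 1) * max 1 (C.f c)) := by
        have := maxZeroRegions_le_mul_f hD c
        nlinarith [mul_le_mul_of_nonneg_left this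
          (by positivity : (0 : ℝ) ≤ 2 ^ (2 * (b + 1) * Q))]
    _ ≤ (1 + D * (Q * b + 1) ^ b) * max 1 (C.f c) +
          2 ^ (2 * (b + 1) * Q) * ((D + 1) * max 1 (C.f c)) := by gcongr
    _ = growthFactor b D Q * max 1 (C.f c) := by
        push_cast [growthFactor]
        ring

end ConfigSystem

theorem sum_le_sum_sum_of_forall_exists_mem {α κ : Type*} [Fintype κ] {s : Finset α}
    {t : κ → Finset α} (hst : ∀ y ∈ s, ∃ j, y ∈ t j) {h : α → ℝ} (h0 : ∀ y, 0 ≤ h y) :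
    ∑ y ∈ s, h y ≤ ∑ j, ∑ y ∈ t j, h y := by
  classical
  rcases isEmpty_or_nonempty κ with hκ | hκ
  · simp [Finset.eq_empty_of_forall_notMem fun y hy => hκ.elim (hst y hy).choose]
  choose! part hpart using hst
  rw [← Finset.sum_fiberwise s part h]
  refine Finset.sum_le_sum fun j _ =>
    Finset.sum_le_sum_of_subset_of_nonneg (fun y hy => ?_) fun y _ _ => h0 y
  obtain ⟨hys, rfl⟩ := Finset.mem_filter.mp hy
  exact hpart y hys

section Sample

variable {α : Type*} [DecidableEq α] {k q : ℕ}

/-- The elements that occur in a sample of `k` blocks of size `q`, drawn with repetitions. -/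
def sample (φ : Fin k → Fin q → α) : Finset α :=
  Finset.univ.image fun x : Fin k × Fin q => φ x.1 x.2

theorem mem_sample {φ : Fin k → Fin q → α} {a : α} : a ∈ sample φ ↔ ∃ j i, φ j i = a := by
  simp [sample]

theorem card_sample_le (φ : Fin k → Fin q → α) : (sample φ).card ≤ k * q :=
  Finset.card_image_le.trans_eq (by simp)

theorem sample_removeNth_subset (φ : Fin (k + 1) → Fin q → α) (j : Fin (k + 1)) :
    sample (j.removeNth φ) ⊆ sample φ := fun a ha => by
  obtain ⟨j', i, rfl⟩ := mem_sample.mp ha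
  exact mem_sample.mpr ⟨j.succAbove j', i, rfl⟩

end Sample

namespace ConfigSystem

variable {U : Type u} {ι : Type v} {C : ConfigSystem.{u, v, w} U ι} {b q : ℕ} {α : Type*}

theorem exists_mem_zeroFinset_removeNth [DecidableEq α] [DecidableEq ι]
    (hb : C.DefinedByAtMost b) (π : α → ι) {φ : Fin (b + 1) → Fin q → α} {y : C.Region}
    (hy : y ∈ C.zeroFinset ((sample φ).image π)) :
    ∃ j : Fin (b + 1), y ∈ C.zeroFinset ((sample (j.removeNth φ)).image π) ∧
      ∀ i, ¬ C.Conflict y (π (φ j i)) := by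
  obtain ⟨hdefs, hconflict⟩ := mem_zeroFinset.mp hy
  have hblock : ∀ s : C.defs y, ∃ j i, π (φ j i) = s := fun s => by
    obtain ⟨a, ha, hs⟩ := Finset.mem_image.mp (hdefs s.2)
    obtain ⟨j, i, rfl⟩ := mem_sample.mp ha
    exact ⟨j, i, hs⟩
  choose block index hblock using hblock
  obtain ⟨j, hj⟩ : ∃ j, j ∉ Finset.univ.image block := by
    by_contra! hall
    have := calc b + 1 = (Finset.univ : Finset (Fin (b + 1))).card := by simp
      _ ≤ (Finset.univ.image block).card := Finset.card_le_card fun j _ => hall j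
      _ ≤ (C.defs y).card := Finset.card_image_le.trans_eq (by simp)
      _ ≤ b := hb y
    omega
  refine ⟨j, mem_zeroFinset_of_subset (Finset.image_subset_image (sample_removeNth_subset φ j))
    hy fun s hs => ?_,
    fun i => hconflict _ (Finset.mem_image_of_mem π (mem_sample.mpr ⟨j, i, rfl⟩))⟩
  obtain ⟨j', hj'⟩ := Fin.exists_succAbove_eq (x := block ⟨s, hs⟩) (y := j) fun h =>
    hj (h ▸ Finset.mem_image_of_mem block (Finset.mem_univ _))
  refine Finset.mem_image.mpr ⟨_, mem_sample.mpr ⟨j', index ⟨s, hs⟩, rfl⟩, ?_⟩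
  rw [Fin.removeNth_apply, hj', hblock]

open Classical in
theorem sum_zeroFinset_sample_le [DecidableEq α] [DecidableEq ι]
    (hb : C.DefinedByAtMost b) (π : α → ι) (φ : Fin (b + 1) → Fin q → α) {h : C.Region → ℝ}
    (h0 : ∀ y, 0 ≤ h y) :
    ∑ y ∈ C.zeroFinset ((sample φ).image π), h y ≤
      ∑ j : Fin (b + 1), ∑ y ∈ (C.zeroFinset ((sample (j.removeNth φ)).image π)).filter
        fun y => ∀ i, ¬ C.Conflict y (π (φ j i)), h y := by
  refine sum_le_sum_sum_of_forall_exists_mem (fun y hy => ?_) h0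
  obtain ⟨j, hmem, hj⟩ := exists_mem_zeroFinset_removeNth hb π hy
  exact ⟨j, Finset.mem_filter.mpr ⟨hmem, hj⟩⟩

variable [Fintype α]

open Classical in
/-- The elements of a family `π` of objects that are in conflict with `y`. -/
noncomputable def conflicts (C : ConfigSystem.{u, v, w} U ι) (π : α → ι) (y : C.Region) :
    Finset α :=
  Finset.univ.filter fun a => C.Conflict y (π a)

theorem mem_conflicts {π : α → ι} {y : C.Region} {a : α} :
    a ∈ C.conflicts π y ↔ C.Conflict y (π a) := by
  simp [conflicts]

/-- The proportion of the elements of a family `π` of objects that are in conflict with `y`; it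
is `0` for the empty family. -/
noncomputable def density (C : ConfigSystem.{u, v, w} U ι) (π : α → ι) (y : C.Region) : ℝ :=
  ((C.conflicts π y).card : ℝ) / (Fintype.card α : ℝ)

theorem density_nonneg (C : ConfigSystem.{u, v, w} U ι) (π : α → ι) (y : C.Region) :
    0 ≤ C.density π y := by
  unfold density
  positivity

theorem density_le_one (C : ConfigSystem.{u, v, w} U ι) (π : α → ι) (y : C.Region) :
    C.density π y ≤ 1 :=
  div_le_one_of_le₀ (Nat.cast_le.mpr (Finset.card_le_univ _)) (Nat.cast_nonneg _)

theorem card_mul_density (C : ConfigSystem.{u, v, w} U ι) (π : α → ι) (y : C.Region) :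
    (Fintype.card α : ℝ) * C.density π y = (C.conflicts π y).card :=
  mul_div_cancel_of_imp' fun h => by
    have := Finset.card_le_univ (C.conflicts π y)
    exact_mod_cast Nat.le_zero.mp (this.trans_eq (Nat.cast_eq_zero.mp h))

theorem one_sub_density_pow_le (C : ConfigSystem.{u, v, w} U ι) (π : α → ι) (y : C.Region)
    (q : ℕ) : (1 - C.density π y) ^ q ≤ Real.exp (-(q * C.density π y)) :=
  calc (1 - C.density π y) ^ q ≤ Real.exp (-C.density π y) ^ q :=
        pow_le_pow_left₀ (sub_nonneg.mpr (C.density_le_one π y)) (Real.one_sub_le_exp_neg _) q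
    _ = Real.exp (-(q * C.density π y)) := by rw [← Real.exp_nat_mul, mul_neg]

open Classical in
theorem card_avoiding (C : ConfigSystem.{u, v, w} U ι) (π : α → ι) (y : C.Region) (q : ℕ) :
    ((Finset.univ.filter fun ψ : Fin q → α => ∀ i, ¬ C.Conflict y (π (ψ i))).card : ℝ) =
      (Fintype.card α : ℝ) ^ q * (1 - C.density π y) ^ q := by
  have hpi : (Finset.univ.filter fun ψ : Fin q → α => ∀ i, ¬ C.Conflict y (π (ψ i))) =
      Fintype.piFinset fun _ : Fin q => (C.conflicts π y)ᶜ := by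
    ext ψ
    simp [Fintype.mem_piFinset, mem_conflicts]
  rw [hpi, Fintype.card_piFinset_const, Finset.card_compl, Nat.cast_pow,
    Nat.cast_sub (Finset.card_le_univ _), ← card_mul_density, ← mul_pow, mul_one_sub]

open Classical in
theorem sum_avoiding_le (π : α → ι) (Z : Finset C.Region) (h : C.Region → ℝ) {c₀ : ℝ}
    (hh : ∀ y, (1 - C.density π y) ^ q * h y ≤ c₀) :
    ∑ ψ : Fin q → α, ∑ y ∈ Z.filter fun y => ∀ i, ¬ C.Conflict y (π (ψ i)), h y ≤
      (Fintype.card α : ℝ) ^ q * (Z.card * c₀) := by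
  calc ∑ ψ : Fin q → α, ∑ y ∈ Z.filter fun y => ∀ i, ¬ C.Conflict y (π (ψ i)), h y
      = ∑ y ∈ Z, ∑ ψ : Fin q → α, if ∀ i, ¬ C.Conflict y (π (ψ i)) then h y else 0 := by
        simp only [Finset.sum_filter]
        exact Finset.sum_comm
    _ = ∑ y ∈ Z, (Fintype.card α : ℝ) ^ q * ((1 - C.density π y) ^ q * h y) := by
        simp only [← Finset.sum_filter, Finset.sum_const, nsmul_eq_mul, card_avoiding, mul_assoc]
    _ ≤ ∑ _y ∈ Z, (Fintype.card α : ℝ) ^ q * c₀ := by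
        gcongr with y
        exact hh y
    _ = (Fintype.card α : ℝ) ^ q * (Z.card * c₀) := by
        rw [Finset.sum_const, nsmul_eq_mul]
        ring

variable [DecidableEq ι]

open Classical in
theorem sum_sample_removeNth_le [DecidableEq α] (π : α → ι) (j : Fin (b + 1))
    (h : C.Region → ℝ) {c₀ : ℝ} (hc : 0 ≤ c₀)
    (hh : ∀ y, (1 - C.density π y) ^ q * h y ≤ c₀) :
    ∑ φ : Fin (b + 1) → Fin q → α, ∑ y ∈ (C.zeroFinset ((sample (j.removeNth φ)).image π)).filter
        (fun y => ∀ i, ¬ C.Conflict y (π (φ j i))), h y ≤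
      Fintype.card (Fin (b + 1) → Fin q → α) * (C.maxZeroRegions (b * q) * c₀) := by
  calc _ = ∑ φ' : Fin b → Fin q → α, ∑ ψ : Fin q → α,
          ∑ y ∈ (C.zeroFinset ((sample φ').image π)).filter
            fun y => ∀ i, ¬ C.Conflict y (π (ψ i)), h y := by
        have hremove : ∀ x, j.removeNth (Fin.insertNthEquiv (fun _ => Fin q → α) j x) = x.2 :=
          fun x => Fin.removeNth_insertNth _ _ _
        rw [← (Fin.insertNthEquiv (fun _ => Fin q → α) j).sum_comp, Fintype.sum_prod_type_right]
        simp [hremove]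
    _ ≤ ∑ _φ' : Fin b → Fin q → α,
          (Fintype.card α : ℝ) ^ q * (C.maxZeroRegions (b * q) * c₀) := by
        gcongr with φ'
        refine (sum_avoiding_le π _ h hh).trans ?_
        gcongr
        exact card_zeroFinset_le_maxZeroRegions (Finset.card_image_le.trans (card_sample_le φ'))
    _ = Fintype.card (Fin (b + 1) → Fin q → α) * (C.maxZeroRegions (b * q) * c₀) := by
        simp only [Finset.sum_const, Finset.card_univ, Fintype.card_fun, Fintype.card_fin,
          nsmul_eq_mul]
        push_cast
        ring

theorem exists_sum_zeroFinset_sample_le [Nonempty α] (hb : C.DefinedByAtMost b) (π : α → ι)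
    {h : C.Region → ℝ} (h0 : ∀ y, 0 ≤ h y) {c₀ : ℝ} (hc : 0 ≤ c₀)
    (hh : ∀ y, (1 - C.density π y) ^ q * h y ≤ c₀) :
    ∃ R : Finset α, R.card ≤ (b + 1) * q ∧
      ∑ y ∈ C.zeroFinset (R.image π), h y ≤ (b + 1) * (C.maxZeroRegions (b * q) * c₀) := by
  classical
  suffices ∑ φ : Fin (b + 1) → Fin q → α, ∑ y ∈ C.zeroFinset ((sample φ).image π), h y ≤
      ∑ _φ : Fin (b + 1) → Fin q → α, (b + 1) * (C.maxZeroRegions (b * q) * c₀) by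
    obtain ⟨φ, _, hφ⟩ := Finset.exists_le_of_sum_le Finset.univ_nonempty this
    exact ⟨sample φ, card_sample_le φ, hφ⟩
  calc _ ≤ ∑ φ : Fin (b + 1) → Fin q → α, ∑ j : Fin (b + 1),
          ∑ y ∈ (C.zeroFinset ((sample (j.removeNth φ)).image π)).filter
            fun y => ∀ i, ¬ C.Conflict y (π (φ j i)), h y :=
        Finset.sum_le_sum fun φ _ => sum_zeroFinset_sample_le hb π φ h0
    _ ≤ ∑ _j : Fin (b + 1),
          Fintype.card (Fin (b + 1) → Fin q → α) * (C.maxZeroRegions (b * q) * c₀) := by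
        rw [Finset.sum_comm]
        exact Finset.sum_le_sum fun j _ => sum_sample_removeNth_le π j h hc hh
    _ = _ := by
        simp only [Finset.sum_const, Finset.card_univ, Fintype.card_fin, nsmul_eq_mul]
        push_cast
        ring

end ConfigSystem

theorem mul_exp_neg_le_one (x : ℝ) : x * Real.exp (-x) ≤ 1 :=
  (Real.mul_exp_neg_le_exp_neg_one x).trans (Real.exp_le_one_iff.mpr (by norm_num))

theorem add_one_sq_mul_exp_neg_le {x : ℝ} (hx : 0 ≤ x) : (x + 1) ^ 2 * Real.exp (-x) ≤ 4 := by
  have hexp : Real.exp (-x) = Real.exp (-(x / 2)) ^ 2 := by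
    rw [← Real.exp_nat_mul]
    congr 1
    push_cast
    ring
  have hhalf : (x + 1) * Real.exp (-(x / 2)) ≤ 2 :=
    calc (x + 1) * Real.exp (-(x / 2)) ≤ 2 * (Real.exp (x / 2) * Real.exp (-(x / 2))) := by
          rw [← mul_assoc]
          gcongr
          linarith [Real.add_one_le_exp (x / 2)]
      _ = 2 := by rw [← Real.exp_add, add_neg_cancel, Real.exp_zero, mul_one]
  calc (x + 1) ^ 2 * Real.exp (-x) = ((x + 1) * Real.exp (-(x / 2))) ^ 2 := by rw [hexp, mul_pow]
    _ ≤ 2 ^ 2 := by gcongr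
    _ = 4 := by norm_num

/-- The factor `k` such that a sample of `(b + 1) * (k * t ^ 2)` objects yields a `1/t`-net,
see `succ_mul_exp_neg_mul_lt_one`. -/
def netFactor (b D : ℕ) : ℕ :=
  (b + 1) ^ (b + 1) * D * (2 * b + 1).factorial + 1

/-- The constant in the bound on the size of the smallest `1/r`-nets. -/
def netSize (b D : ℕ) : ℕ :=
  (8 * (b + 1) ^ 2 + 16 * netFactor b D * (b + 1) ^ 4) * (D + 1)

theorem succ_mul_exp_neg_mul_lt_one {b D : ℕ} {x : ℝ} (hx : netFactor b D ≤ x) :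
    (b + 1) * (D * ((b + 1) * x ^ 2) ^ b * Real.exp (-x)) < 1 := by
  set K : ℝ := (b + 1) ^ (b + 1) * D with hK
  have hlt : K * (2 * b + 1).factorial < x := by
    push_cast [netFactor] at hx
    linarith
  have hx0 : 0 < x := lt_of_le_of_lt (by positivity) hlt
  have hexp : x ^ (2 * b + 1) * Real.exp (-x) ≤ (2 * b + 1).factorial := by
    have := Real.pow_div_factorial_le_exp x hx0.le (2 * b + 1)
    rw [div_le_iff₀ (by positivity)] at this
    calc _ ≤ Real.exp x * (2 * b + 1).factorial * Real.exp (-x) := by gcongr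
      _ = (2 * b + 1).factorial := by
          rw [mul_right_comm, ← Real.exp_add, add_neg_cancel, Real.exp_zero, one_mul]
  refine lt_of_mul_lt_mul_right ?_ hx0.le
  calc (b + 1) * (D * ((b + 1) * x ^ 2) ^ b * Real.exp (-x)) * x
      = K * (x ^ (2 * b + 1) * Real.exp (-x)) := by
        rw [hK, mul_pow, ← pow_mul]
        ring
    _ ≤ K * (2 * b + 1).factorial := by gcongr
    _ < 1 * x := by rwa [one_mul]

namespace ConfigSystem

variable {U : Type u} {ι : Type v} {C : ConfigSystem.{u, v, w} U ι} {b D r : ℕ} {α : Type*}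

theorem IsComplete.exists_mem_zeroFinset [DecidableEq ι] (hC : C.IsComplete) (π : α → ι)
    (R : Finset α) {p : U} (hp : ∀ a ∈ R, p ∉ C.obj (π a)) :
    ∃ y ∈ C.zeroFinset (R.image π), ∀ a, p ∈ C.obj (π a) → C.Conflict y (π a) := by
  obtain ⟨y, hy, hpy⟩ := hC (R.image π) p (by simpa using hp)
  exact ⟨y, mem_zeroFinset.mpr hy, fun a ha => C.conflict_of_meets _ _ ⟨p, hpy, ha⟩⟩

/-- Each member of the family `N` has a private point: one that lies in no other member. -/
def HasPrivatePoints (C : ConfigSystem.{u, v, w} U ι) (π : α → ι) (N : Finset α) : Prop :=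
  ∀ a ∈ N, ∃ p ∈ C.obj (π a), ∀ a' ∈ N, a' ≠ a → p ∉ C.obj (π a')

theorem HasPrivatePoints.mono {π : α → ι} {N N' : Finset α} (hN : C.HasPrivatePoints π N)
    (h : N' ⊆ N) : C.HasPrivatePoints π N' := fun a ha =>
  let ⟨p, hp, hpriv⟩ := hN a (h ha)
  ⟨p, hp, fun a' ha' => hpriv a' (h ha')⟩

variable [Fintype α]

/-- `N` is a `1/r`-net of the family `π` of objects. Multisets of objects are treated as families,
and the condition that a point lies in a proportion `1/r` of them as one on integers. -/
def IsFamilyNet (C : ConfigSystem.{u, v, w} U ι) (π : α → ι) (r : ℕ) (N : Finset α) : Prop :=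
  ∀ p, Fintype.card α ≤ r * {a | p ∈ C.obj (π a)}.ncard → ∃ a ∈ N, p ∈ C.obj (π a)

theorem isNet_copies_iff {n : ℕ} {C : ConfigSystem.{u, 0, w} U (Fin n)} {m : Fin n → ℕ}
    (hr : 0 < r) {N : Finset (Copy m)} :
    (C.copies m).IsNet (1 / (r : ℝ)) N ↔ C.IsFamilyNet Sigma.fst r N := by
  have hr0 : (0 : ℝ) < r := Nat.cast_pos.mpr hr
  refine forall_congr' fun p => imp_congr_left ?_
  rw [one_div, inv_mul_le_iff₀ hr0]
  exact_mod_cast Iff.rfl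

theorem IsFamilyNet.exists_subset_hasPrivatePoints {π : α → ι} {N₀ : Finset α}
    (hN₀ : C.IsFamilyNet π r N₀) :
    ∃ N ⊆ N₀, C.IsFamilyNet π r N ∧ C.HasPrivatePoints π N := by
  classical
  obtain ⟨N, hsub, hnet, hmin⟩ := exists_minimal_le_of_wellFoundedLT (C.IsFamilyNet π r) N₀ hN₀
  refine ⟨N, hsub, hnet, fun a ha => ?_⟩
  have herase : ¬ C.IsFamilyNet π r (N.erase a) := fun h =>
    Finset.notMem_erase a N (hmin h (Finset.erase_subset a N) ha)
  simp only [IsFamilyNet, not_forall, not_exists, not_and] at herase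
  obtain ⟨p, hp, hnot⟩ := herase
  have hpriv : ∀ a' ∈ N, a' ≠ a → p ∉ C.obj (π a') :=
    fun a' ha' hne => hnot a' (Finset.mem_erase.mpr ⟨hne, ha'⟩)
  obtain ⟨a', ha', hpa'⟩ := hnet p hp
  obtain rfl : a' = a := not_not.mp fun hne => hpriv a' ha' hne hpa'
  exact ⟨p, hpa', hpriv⟩

theorem ncard_le_card_conflicts {π : α → ι} {y : C.Region} {p : U}
    (h : ∀ a, p ∈ C.obj (π a) → C.Conflict y (π a)) :
    {a | p ∈ C.obj (π a)}.ncard ≤ (C.conflicts π y).card := by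
  rw [← Set.ncard_coe_finset]
  exact Set.ncard_le_ncard (fun a ha => mem_conflicts.mpr (h a ha)) (Finset.finite_toSet _)

theorem ncard_eq_ncard_conflicts {π : α → ι} {y : C.Region} {p : U}
    (h : ∀ a, p ∈ C.obj (π a) → C.Conflict y (π a)) :
    {a | p ∈ C.obj (π a)}.ncard = {a : C.conflicts π y | p ∈ C.obj (π a)}.ncard := by
  have himage : {a | p ∈ C.obj (π a)} =
      Subtype.val '' {a : C.conflicts π y | p ∈ C.obj (π a)} := by
    ext a
    exact ⟨fun ha => ⟨⟨a, mem_conflicts.mpr (h a ha)⟩, ha, rfl⟩,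
      by rintro ⟨a, ha, rfl⟩; exact ha⟩
  rw [himage, Set.ncard_image_of_injective _ Subtype.val_injective]

theorem exists_sample_mul_density_lt_one [DecidableEq ι] [Nonempty α] (hb : C.DefinedByAtMost b)
    (hD : C.DefinesAtMost D) (π : α → ι) {t : ℕ} (ht : 1 ≤ t) :
    ∃ R : Finset α, R.card ≤ (b + 1) * (netFactor b D * t ^ 2) ∧
      ∀ y ∈ C.zeroFinset (R.image π), t * C.density π y < 1 := by
  set q := netFactor b D * t ^ 2 with hq
  set x : ℝ := netFactor b D * t with hx
  have ht' : (1 : ℝ) ≤ t := by exact_mod_cast ht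
  have hfactor : (1 : ℝ) ≤ netFactor b D := by exact_mod_cast Nat.le_add_left 1 _
  have hfactor_le : netFactor b D ≤ x := le_mul_of_one_le_right (by positivity) ht'
  obtain ⟨R, hR, hsum⟩ := exists_sum_zeroFinset_sample_le hb π (q := q)
    (h := fun y => if 1 ≤ t * C.density π y then 1 else 0) (fun y => by positivity)
    (Real.exp_pos (-x)).le fun y => by
      split_ifs with hy
      · rw [mul_one]
        refine (C.one_sub_density_pow_le π y q).trans (Real.exp_le_exp.mpr (neg_le_neg ?_))
        calc x ≤ x * (t * C.density π y) := le_mul_of_one_le_right (by positivity) hy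
          _ = q * C.density π y := by
              rw [hq, hx]
              push_cast
              ring
      · simpa using (Real.exp_pos (-x)).le
  refine ⟨R, hR, fun y hy => ?_⟩
  by_contra! hdense
  refine absurd (succ_mul_exp_neg_mul_lt_one hfactor_le) (not_lt.mpr ?_)
  have hq_le : (b * q + 1 : ℝ) ≤ (b + 1) * x ^ 2 := by
    have hqx : (q : ℝ) ≤ x ^ 2 := by
      rw [hq, hx, mul_pow]
      push_cast
      gcongr
      exact le_self_pow₀ hfactor two_ne_zero
    nlinarith [hfactor.trans hfactor_le, Nat.cast_nonneg (α := ℝ) b]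
  have hmax : (C.maxZeroRegions (b * q) : ℝ) ≤ D * (b * q + 1) ^ b := by
    exact_mod_cast maxZeroRegions_le_pow hb hD (b * q)
  calc (1 : ℝ) = if 1 ≤ t * C.density π y then 1 else 0 := (if_pos hdense).symm
    _ ≤ _ := Finset.single_le_sum (f := fun y => if 1 ≤ t * C.density π y then (1 : ℝ) else 0)
        (fun y _ => by positivity) hy
    _ ≤ (b + 1) * (C.maxZeroRegions (b * q) * Real.exp (-x)) := hsum
    _ ≤ (b + 1) * (D * ((b + 1) * x ^ 2) ^ b * Real.exp (-x)) := by
        gcongr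
        exact hmax.trans (by gcongr)

theorem exists_isFamilyNet_sq [Nonempty α] (hC : C.IsComplete) (hb : C.DefinedByAtMost b)
    (hD : C.DefinesAtMost D) (π : α → ι) {t : ℕ} (ht : 1 ≤ t) :
    ∃ N : Finset α, N.card ≤ (b + 1) * (netFactor b D * t ^ 2) ∧ C.IsFamilyNet π t N := by
  classical
  obtain ⟨R, hR, hdensity⟩ := exists_sample_mul_density_lt_one hb hD π ht
  refine ⟨R, hR, fun p hp => ?_⟩
  by_contra! hcov
  obtain ⟨y, hy, hconflict⟩ := hC.exists_mem_zeroFinset π R hcov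
  refine absurd (hdensity y hy) (not_lt.mpr ?_)
  rw [density, ← mul_div_assoc, one_le_div (by simp [Fintype.card_pos])]
  exact_mod_cast hp.trans (Nat.mul_le_mul_left t (ncard_le_card_conflicts hconflict))

theorem exists_net_in_conflicts [Nonempty α] (hC : C.IsComplete) (hb : C.DefinedByAtMost b)
    (hD : C.DefinesAtMost D) (π : α → ι) (r : ℕ) (y : C.Region) :
    ∃ N : Finset α, (N.card : ℝ) ≤ (b + 1) * netFactor b D * (r * C.density π y + 1) ^ 2 ∧
      ∀ p, (∀ a, p ∈ C.obj (π a) → C.Conflict y (π a)) →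
        Fintype.card α ≤ r * {a | p ∈ C.obj (π a)}.ncard → ∃ a ∈ N, p ∈ C.obj (π a) := by
  rcases le_or_gt (r * C.density π y) 0 with hzero | hpos
  · refine ⟨∅, by simp only [Finset.card_empty, Nat.cast_zero]; positivity, fun p hcon hp => ?_⟩
    have hheavy : (Fintype.card α : ℝ) ≤ r * (C.conflicts π y).card := by
      exact_mod_cast hp.trans (Nat.mul_le_mul_left r (ncard_le_card_conflicts hcon))
    rw [← card_mul_density] at hheavy
    have hα : (0 : ℝ) < Fintype.card α := Nat.cast_pos.mpr Fintype.card_pos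
    nlinarith
  set t := ⌈r * C.density π y⌉₊
  have : Nonempty (C.conflicts π y) := by
    refine (Finset.card_pos.mp (Nat.pos_of_ne_zero fun h => ?_)).to_subtype
    simp [density, h] at hpos
  obtain ⟨N, hN, hnet⟩ := exists_isFamilyNet_sq hC hb hD
    (fun a : C.conflicts π y => π a) (t := t) (Nat.one_le_ceil_iff.mpr hpos)
  refine ⟨N.map (Function.Embedding.subtype _), ?_, fun p hcon hp => ?_⟩
  · rw [Finset.card_map, mul_assoc]
    calc (N.card : ℝ) ≤ (b + 1) * (netFactor b D * t ^ 2) := by exact_mod_cast hN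
      _ ≤ (b + 1) * (netFactor b D * (r * C.density π y + 1) ^ 2) := by
          gcongr
          exact (Nat.ceil_lt_add_one hpos.le).le
  · rw [ncard_eq_ncard_conflicts hcon] at hp
    set d := {a : C.conflicts π y | p ∈ C.obj (π a)}.ncard
    obtain ⟨a, ha, hpa⟩ := hnet p (by
      rw [Fintype.card_coe, ← Nat.cast_le (α := ℝ), ← card_mul_density]
      calc (Fintype.card α : ℝ) * C.density π y ≤ (r * d : ℕ) * C.density π y := by
            gcongr
            exact C.density_nonneg π y
        _ = r * C.density π y * d := by
            push_cast
            ring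
        _ ≤ (t * d : ℕ) := by
            push_cast
            gcongr
            exact Nat.le_ceil _)
    exact ⟨a, Finset.mem_map_of_mem _ ha, hpa⟩

theorem one_sub_density_pow_mul_sq_le (π : α → ι) (y : C.Region) {k q : ℕ}
    (hr : r ≤ 2 * (b + 1) * q) :
    (1 - C.density π y) ^ q * ((b + 1) * k * (r * C.density π y + 1) ^ 2) ≤
      16 * k * (b + 1) ^ 3 := by
  have hd := C.density_nonneg π y
  set x := q * C.density π y
  have hx0 : 0 ≤ x := by positivity
  have hlin : r * C.density π y + 1 ≤ 2 * (b + 1) * (x + 1) := by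
    have : r * C.density π y ≤ (2 * (b + 1) * q : ℕ) * C.density π y := by gcongr
    push_cast at this
    nlinarith [Nat.cast_nonneg (α := ℝ) b]
  calc _ ≤ Real.exp (-x) * ((b + 1) * k * (2 * (b + 1) * (x + 1)) ^ 2) := by
        have := C.one_sub_density_pow_le π y q
        gcongr
    _ = 4 * k * (b + 1) ^ 3 * ((x + 1) ^ 2 * Real.exp (-x)) := by ring
    _ ≤ 4 * k * (b + 1) ^ 3 * 4 := by
        gcongr
        exact add_one_sq_mul_exp_neg_le hx0
    _ = 16 * k * (b + 1) ^ 3 := by ring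

theorem exists_isFamilyNet_add [Nonempty α] (hC : C.IsComplete) (hb : C.DefinedByAtMost b)
    (hD : C.DefinesAtMost D) (π : α → ι) {q : ℕ} (hr : r ≤ 2 * (b + 1) * q) :
    ∃ N : Finset α, (N.card : ℝ) ≤
        (b + 1) * q + 16 * netFactor b D * (b + 1) ^ 4 * C.maxZeroRegions (b * q) ∧
      C.IsFamilyNet π r N := by
  classical
  choose N hN hnet using fun y => exists_net_in_conflicts hC hb hD π r y
  obtain ⟨R, hR, hsum⟩ := exists_sum_zeroFinset_sample_le hb π (q := q)
    (h := fun y => (b + 1) * netFactor b D * (r * C.density π y + 1) ^ 2)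
    (fun y => by positivity) (by positivity) fun y => one_sub_density_pow_mul_sq_le π y hr
  refine ⟨R ∪ (C.zeroFinset (R.image π)).biUnion N, ?_, fun p hp => ?_⟩
  · calc ((R ∪ (C.zeroFinset (R.image π)).biUnion N).card : ℝ)
        ≤ R.card + ∑ y ∈ C.zeroFinset (R.image π), ((N y).card : ℝ) := by
          exact_mod_cast (Finset.card_union_le _ _).trans
            (Nat.add_le_add_left Finset.card_biUnion_le _)
      _ ≤ (b + 1) * q +
            (b + 1) * (C.maxZeroRegions (b * q) * (16 * netFactor b D * (b + 1) ^ 3)) :=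
          add_le_add (by exact_mod_cast hR) ((Finset.sum_le_sum fun y _ => hN y).trans hsum)
      _ = _ := by ring
  · by_cases hcov : ∃ a ∈ R, p ∈ C.obj (π a)
    · obtain ⟨a, ha, hpa⟩ := hcov
      exact ⟨a, Finset.mem_union_left _ ha, hpa⟩
    · push Not at hcov
      obtain ⟨y, hy, hcon⟩ := hC.exists_mem_zeroFinset π R hcov
      obtain ⟨a, ha, hpa⟩ := hnet y p hcon hp
      exact ⟨a, Finset.mem_union_right _ (Finset.mem_biUnion.mpr ⟨y, hy, ha⟩), hpa⟩

theorem exists_sample_sum_card_conflicts_le [DecidableEq ι] [Nonempty α]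
    (hb : C.DefinedByAtMost b) (π : α → ι) {q : ℕ} (hq : Fintype.card α ≤ 4 * (b + 1) * q) :
    ∃ R : Finset α, R.card ≤ (b + 1) * q ∧
      ∑ y ∈ C.zeroFinset (R.image π), (C.conflicts π y).card ≤
        4 * (b + 1) ^ 2 * C.maxZeroRegions (b * q) := by
  obtain ⟨R, hR, hsum⟩ := exists_sum_zeroFinset_sample_le hb π (q := q)
    (h := fun y => ((C.conflicts π y).card : ℝ)) (c₀ := 4 * (b + 1)) (fun y => by positivity)
    (by positivity) fun y => by
      have hd := C.density_nonneg π y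
      set x := q * C.density π y with hx
      calc (1 - C.density π y) ^ q * (C.conflicts π y).card
          ≤ Real.exp (-x) * ((4 * (b + 1) * q : ℕ) * C.density π y) := by
            have := C.one_sub_density_pow_le π y q
            rw [← card_mul_density]
            gcongr
        _ = 4 * (b + 1) * (x * Real.exp (-x)) := by
            rw [hx]
            push_cast
            ring
        _ ≤ 4 * (b + 1) := mul_le_of_le_one_right (by positivity) (mul_exp_neg_le_one x)
  refine ⟨R, hR, ?_⟩
  have : (∑ y ∈ C.zeroFinset (R.image π), ((C.conflicts π y).card : ℝ)) ≤
      4 * (b + 1) ^ 2 * C.maxZeroRegions (b * q) := hsum.trans_eq (by ring)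
  exact_mod_cast this

theorem card_le_of_forall_exists_private (hC : C.IsComplete) (hb : C.DefinedByAtMost b)
    (π : α → ι) (hpriv : ∀ a, ∃ p ∈ C.obj (π a), ∀ a', a' ≠ a → p ∉ C.obj (π a')) :
    Fintype.card α ≤ 8 * (b + 1) ^ 2 * max 1 (C.maxZeroRegions (Fintype.card α)) := by
  classical
  set n := Fintype.card α
  set q := n / (2 * (b + 1))
  have hqn : 2 * (b + 1) * q ≤ n := Nat.mul_div_le n _
  have hnq : n < 2 * (b + 1) * (q + 1) := Nat.lt_mul_div_succ n (by positivity)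
  rcases Nat.eq_zero_or_pos q with hq | hq
  · rw [hq] at hnq
    nlinarith [le_max_left 1 (C.maxZeroRegions n)]
  have : Nonempty α := Fintype.card_pos_iff.mp ((by positivity : 0 < 2 * (b + 1) * q).trans_le hqn)
  obtain ⟨R, hR, hsum⟩ := exists_sample_sum_card_conflicts_le hb π
    (q := q) (hnq.le.trans (by nlinarith))
  -- The private point of an object outside the sample is uncovered, so it lies in a `0`-region.
  have hcover : Rᶜ ⊆ (C.zeroFinset (R.image π)).biUnion (C.conflicts π) := fun a ha => by
    obtain ⟨p, hp, hother⟩ := hpriv a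
    obtain ⟨y, hy, hcon⟩ := hC.exists_mem_zeroFinset π R (p := p)
      fun a' ha' => hother a' fun h => Finset.mem_compl.mp ha (h ▸ ha')
    exact Finset.mem_biUnion.mpr ⟨y, hy, mem_conflicts.mpr (hcon a hp)⟩
  have hhalf : n ≤ 2 * Rᶜ.card := by
    rw [Finset.card_compl]
    have : 2 * (b + 1) * q = 2 * ((b + 1) * q) := mul_assoc _ _ _
    omega
  calc n ≤ 2 * Rᶜ.card := hhalf
    _ ≤ 2 * (4 * (b + 1) ^ 2 * C.maxZeroRegions (b * q)) := by
        gcongr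
        exact (Finset.card_le_card hcover).trans (Finset.card_biUnion_le.trans hsum)
    _ ≤ 2 * (4 * (b + 1) ^ 2 * max 1 (C.maxZeroRegions n)) := by
        gcongr
        exact (maxZeroRegions_mono (by nlinarith)).trans (le_max_right _ _)
    _ = _ := by ring

omit [Fintype α] in
theorem HasPrivatePoints.card_le (hC : C.IsComplete) (hb : C.DefinedByAtMost b) {π : α → ι}
    {N : Finset α} (hN : C.HasPrivatePoints π N) :
    N.card ≤ 8 * (b + 1) ^ 2 * max 1 (C.maxZeroRegions N.card) := by
  rw [← Fintype.card_coe N]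
  refine card_le_of_forall_exists_private hC hb (fun a : N => π a) fun a => ?_
  obtain ⟨p, hp, hother⟩ := hN a a.2
  exact ⟨p, hp, fun a' hne => hother a' a'.2 fun h => hne (Subtype.ext h)⟩

omit [Fintype α] in
theorem HasPrivatePoints.min_card_le {π : α → ι} {N : Finset α} (hN : C.HasPrivatePoints π N)
    (hC : C.IsComplete) (hb : C.DefinedByAtMost b) (r : ℕ) :
    min N.card r ≤ 8 * (b + 1) ^ 2 * max 1 (C.maxZeroRegions r) := by
  obtain ⟨N', hN', hcard⟩ := Finset.exists_subset_card_eq (Nat.min_le_left N.card r)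
  have h := (hN.mono hN').card_le hC hb
  rw [hcard] at h
  refine h.trans (Nat.mul_le_mul_left _ (max_le_max_left 1 ?_))
  exact maxZeroRegions_mono (Nat.min_le_right _ _)

theorem exists_isFamilyNet [Fintype ι] [Nonempty α] (hC : C.IsComplete)
    (hb : C.DefinedByAtMost b) (hD : C.DefinesAtMost D) (π : α → ι) (hr : 1 ≤ r)
    (hrb : 2 * b ≤ r) :
    ∃ N : Finset α, (N.card : ℝ) ≤ netSize b D * max 1 (C.f r) ∧ C.IsFamilyNet π r N := by
  classical
  set q := r / (b + 1)
  have hqr : (b + 1) * q ≤ r := Nat.mul_div_le r _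
  have hrq : r < (b + 1) * (q + 1) := Nat.lt_mul_div_succ r b.succ_pos
  have hq : 1 ≤ q := Nat.div_pos (by omega) b.succ_pos
  obtain ⟨N₀, hN₀, hnet₀⟩ := exists_isFamilyNet_add (r := r) hC hb hD π (q := q) (by nlinarith)
  obtain ⟨N, hsub, hnet, hpriv⟩ := hnet₀.exists_subset_hasPrivatePoints
  refine ⟨N, ?_, hnet⟩
  set G : ℝ := (D + 1) * max 1 (C.f r) with hG
  have hmax : ((max 1 (C.maxZeroRegions r) : ℕ) : ℝ) ≤ G := by
    push_cast
    refine max_le ?_ (maxZeroRegions_le_mul_f hD r)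
    nlinarith [le_max_left 1 (C.f r), Nat.cast_nonneg (α := ℝ) D]
  have hsmall : ((min N.card r : ℕ) : ℝ) ≤ 8 * (b + 1) ^ 2 * G :=
    calc ((min N.card r : ℕ) : ℝ)
        ≤ 8 * (b + 1) ^ 2 * (max 1 (C.maxZeroRegions r) : ℕ) := by
          exact_mod_cast hpriv.min_card_le hC hb r
      _ ≤ 8 * (b + 1) ^ 2 * G := by gcongr
  have hlarge : (N.card : ℝ) ≤ r + 16 * netFactor b D * (b + 1) ^ 4 * G :=
    calc (N.card : ℝ) ≤ N₀.card := Nat.cast_le.mpr (Finset.card_le_card hsub)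
      _ ≤ _ := hN₀
      _ ≤ r + 16 * netFactor b D * (b + 1) ^ 4 * G := by
          gcongr
          · exact_mod_cast hqr
          · exact (Nat.cast_le.mpr ((maxZeroRegions_mono (by nlinarith)).trans
              (le_max_right _ _))).trans hmax
  have hG0 : 0 ≤ 16 * netFactor b D * (b + 1) ^ 4 * G := by positivity
  calc (N.card : ℝ) ≤ 8 * (b + 1) ^ 2 * G + 16 * netFactor b D * (b + 1) ^ 4 * G := by
        rcases le_total N.card r with h | h <;> simp only [h, inf_of_le_left, inf_of_le_right]
          at hsmall <;> linarith
    _ = netSize b D * max 1 (C.f r) := by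
        rw [hG]
        push_cast [netSize]
        ring

end ConfigSystem

theorem nonempty_netFinder {U : Type u} {n b D : ℕ} {C : ConfigSystem.{u, 0, w} U (Fin n)}
    (hC : C.IsComplete) (hb : C.DefinedByAtMost b) (hD : C.DefinesAtMost D) :
    Nonempty (NetFinder C b (netSize b D)) := by
  have hex (m : Fin n → ℕ) (r : ℕ) : ∃ N : Finset (ConfigSystem.Copy m),
      1 ≤ r → 2 * b ≤ r → r ≤ ∑ s, m s →
        (C.copies m).IsNet (1 / (r : ℝ)) N ∧ (N.card : ℝ) ≤ netSize b D * max 1 (C.f r) := by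
    by_cases h : 1 ≤ r ∧ 2 * b ≤ r ∧ r ≤ ∑ s, m s
    · obtain ⟨hr, hrb, hm⟩ := h
      have : Nonempty (ConfigSystem.Copy m) := Fintype.card_pos_iff.mp (by simp; omega)
      obtain ⟨N, hN, hnet⟩ := ConfigSystem.exists_isFamilyNet hC hb hD
        (Sigma.fst : ConfigSystem.Copy m → Fin n) hr hrb
      exact ⟨N, fun _ _ _ => ⟨(ConfigSystem.isNet_copies_iff hr).mpr hnet, hN⟩⟩
    · exact ⟨∅, fun hr hrb hm => absurd ⟨hr, hrb, hm⟩ h⟩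
  choose N hN using hex
  exact ⟨⟨fun _ m r => N m r, fun _ _ _ => 0, fun _ m r h₁ h₂ h₃ => (hN m r h₁ h₂ h₃).1,
    fun _ m r h₁ h₂ h₃ => (hN m r h₁ h₂ h₃).2⟩⟩

theorem one_add_inv_pow_le {c r : ℕ} (hr : 1 ≤ r) (h : 4 * c ≤ r) :
    (1 + 1 / (r : ℝ)) ^ c ≤ 4 / 3 := by
  have hr' : (1 : ℝ) ≤ r := by exact_mod_cast hr
  have h' : (4 : ℝ) * c ≤ r := by exact_mod_cast h
  set x : ℝ := 1 / r with hx
  have hx0 : 0 ≤ x := by positivity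
  have hx1 : x ≤ 1 := div_le_one_of_le₀ hr' (by positivity)
  have hcx : c * x ≤ 1 / 4 := by
    rw [hx, mul_one_div, div_le_iff₀ (by linarith)]
    linarith
  have hbernoulli : 3 / 4 ≤ (1 - x) ^ c := by
    have := one_add_mul_le_pow (show (-2 : ℝ) ≤ -x by linarith) c
    rw [← sub_eq_add_neg] at this
    linarith
  have hprod : (1 + x) ^ c * (1 - x) ^ c ≤ 1 := by
    rw [← mul_pow]
    exact pow_le_one₀ (by nlinarith) (by nlinarith)
  have hpos : 0 ≤ (1 + x) ^ c := by positivity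
  nlinarith

theorem le_mul_sq_of_two_pow_le {L n W : ℝ} {e : ℕ} (hL : 0 < L) (hn : 0 ≤ n)
    (hlower : L * 2 ^ e ≤ W) (hupper : W ≤ L * n * (4 / 3) ^ e) : W ≤ L * (n * n) := by
  have hpow : ((3 : ℝ) / 2) ^ e ≤ n := by
    have htwo : (2 : ℝ) ^ e = (3 / 2) ^ e * (4 / 3) ^ e := by rw [← mul_pow]; norm_num
    refine le_of_mul_le_mul_left (a := L * (4 / 3) ^ e) ?_ (by positivity)
    linear_combination hlower.trans hupper - L * htwo
  have hpow' : ((4 : ℝ) / 3) ^ e ≤ n :=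
    (pow_le_pow_left₀ (by norm_num) (by norm_num) _).trans hpow
  calc W ≤ L * n * (4 / 3) ^ e := hupper
    _ ≤ L * n * n := by gcongr
    _ = L * (n * n) := mul_assoc _ _ _

theorem sum_ite_mem_two_mul {ι : Type*} [Fintype ι] [DecidableEq ι] (t : Finset ι) (wt : ι → ℕ) :
    ∑ s, (if s ∈ t then 2 * wt s else wt s) = ∑ s, wt s + ∑ s ∈ t, wt s := by
  conv_rhs => rw [← Finset.univ_inter t, ← Finset.sum_ite_mem, ← Finset.sum_add_distrib]
  exact Finset.sum_congr rfl fun s _ => by by_cases hs : s ∈ t <;> simp [hs, two_mul]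

/-- The weights result from `L` after some number of rounds, in which the total weight increases
by at most a factor `1 + 1 / r`, and the weight of some element of `H` is doubled. -/
def Reweighted {ι : Type*} [Fintype ι] (L r : ℕ) (H : Finset ι) (wt : ι → ℕ) : Prop :=
  ∃ (k : ℕ) (e : ι → ℕ), (∀ s, wt s = L * 2 ^ e s) ∧
    ∑ s, (wt s : ℝ) ≤ L * Fintype.card ι * (1 + 1 / (r : ℝ)) ^ k ∧ k ≤ ∑ s ∈ H, e s

namespace Reweighted

variable {ι : Type*} [Fintype ι] {L r : ℕ} {H t : Finset ι} {wt : ι → ℕ}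

theorem start (L r : ℕ) (H : Finset ι) : Reweighted L r H fun _ => L :=
  ⟨0, 0, by simp [mul_comm]⟩

theorem mul_card_le (h : Reweighted L r H wt) : L * Fintype.card ι ≤ ∑ s, wt s := by
  obtain ⟨k, e, hwt, -⟩ := h
  rw [mul_comm, ← smul_eq_mul, ← Finset.card_univ]
  exact Finset.card_nsmul_le_sum _ _ _ fun s _ => hwt s ▸ Nat.le_mul_of_pos_right _ (by positivity)

theorem pos (hL : 0 < L) (h : Reweighted L r H wt) (s : ι) : 0 < wt s := by
  obtain ⟨k, e, hwt, -⟩ := h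
  rw [hwt]
  positivity

theorem step [DecidableEq ι] (h : Reweighted L r H wt) (hr : 1 ≤ r)
    (hlight : r * ∑ s ∈ t, wt s ≤ ∑ s, wt s) (hH : ¬Disjoint t H) :
    Reweighted L r H fun s => if s ∈ t then 2 * wt s else wt s := by
  obtain ⟨k, e, hwt, hle, hk⟩ := h
  refine ⟨k + 1, fun s => e s + if s ∈ t then 1 else 0, fun s => ?_, ?_, ?_⟩
  · dsimp only
    rw [hwt]
    split_ifs <;> ring
  · have hlight' : (∑ s ∈ t, (wt s : ℝ)) ≤ (∑ s, (wt s : ℝ)) * (1 / r) := by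
      rw [mul_one_div, le_div_iff₀ (by positivity), mul_comm]
      exact_mod_cast hlight
    have hsum : ∑ s, ((if s ∈ t then 2 * wt s else wt s : ℕ) : ℝ) =
        ∑ s, (wt s : ℝ) + ∑ s ∈ t, (wt s : ℝ) := by
      exact_mod_cast sum_ite_mem_two_mul t wt
    calc _ = ∑ s, (wt s : ℝ) + ∑ s ∈ t, (wt s : ℝ) := hsum
      _ ≤ (∑ s, (wt s : ℝ)) * (1 + 1 / r) := by linarith
      _ ≤ L * Fintype.card ι * (1 + 1 / (r : ℝ)) ^ k * (1 + 1 / r) := by gcongr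
      _ = L * Fintype.card ι * (1 + 1 / (r : ℝ)) ^ (k + 1) := by ring
  · obtain ⟨s, hst, hsH⟩ := Finset.not_disjoint_iff.mp hH
    rw [Finset.sum_add_distrib, Finset.sum_boole]
    exact add_le_add hk (Finset.card_pos.mpr ⟨s, by simp [hst, hsH]⟩)

theorem le_mul_sq (h : Reweighted L r H wt) (hL : 0 < L) (hH : H.Nonempty)
    (hr : 4 * H.card ≤ r) : ∑ s, wt s ≤ L * (Fintype.card ι * Fintype.card ι) := by
  obtain ⟨k, e, hwt, hle, hk⟩ := h
  obtain ⟨s, -, hmax⟩ := Finset.exists_max_image H e hH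
  set n := Fintype.card ι
  have hupper : ∑ s, (wt s : ℝ) ≤ L * n * (4 / 3) ^ e s := by
    have hr1 : 1 ≤ r := by have := hH.card_pos; omega
    have hk' : k ≤ H.card * e s := hk.trans (Finset.sum_le_card_nsmul _ _ _ hmax)
    refine hle.trans (mul_le_mul_of_nonneg_left ?_ (by positivity))
    calc (1 + 1 / (r : ℝ)) ^ k ≤ (1 + 1 / (r : ℝ)) ^ (H.card * e s) :=
          pow_le_pow_right₀ (by simp) hk'
      _ = ((1 + 1 / (r : ℝ)) ^ H.card) ^ e s := pow_mul _ _ _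
      _ ≤ (4 / 3) ^ e s := pow_le_pow_left₀ (by positivity) (one_add_inv_pow_le hr1 hr) _
  have hlower : (L * 2 ^ e s : ℝ) ≤ ∑ s, (wt s : ℝ) := by
    refine le_trans (le_of_eq ?_)
      (Finset.single_le_sum (f := fun s => (wt s : ℝ)) (fun _ _ => by positivity)
        (Finset.mem_univ s))
    simp [hwt]
  exact_mod_cast le_mul_sq_of_two_pow_le (Nat.cast_pos.mpr hL) n.cast_nonneg hlower hupper

end Reweighted

namespace ConfigSystem

variable {U : Type u} {n : ℕ} {C : ConfigSystem.{u, 0, w} U (Fin n)} {b r : ℕ} {A : ℝ}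

theorem ncard_copies_mem (m : Fin n → ℕ) (t : Finset (Fin n)) :
    {a : Copy m | a.1 ∈ t}.ncard = ∑ s ∈ t, m s := by
  have h : {a : Copy m | a.1 ∈ t} = (t.sigma fun _ => Finset.univ : Finset (Copy m)) := by
    ext
    simp
  rw [h, Set.ncard_coe_finset]
  simp

theorem IsNet.mul_sum_lt {m : Fin n → ℕ} {N : Finset (Copy m)}
    (hN : (C.copies m).IsNet (1 / (r : ℝ)) N) (hr : 0 < r) {p : U} {t : Finset (Fin n)}
    (ht : ∀ s, s ∈ t ↔ p ∈ C.obj s) (hdisj : Disjoint t (N.image Sigma.fst)) :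
    r * ∑ s ∈ t, m s < ∑ s, m s := by
  by_contra! hle
  have hset : {a : Copy m | p ∈ C.obj a.1} = {a : Copy m | a.1 ∈ t} := by simp [ht]
  obtain ⟨a, haN, hpa⟩ := (isNet_copies_iff hr).mp hN p
    (by simpa [hset, ncard_copies_mem, Copy] using hle)
  exact Finset.disjoint_left.mp hdisj ((ht _).mpr hpa) (Finset.mem_image_of_mem _ haN)

end ConfigSystem

namespace Store

variable {σ : Store} {n x y k l : ℕ}

@[simp] theorem reg_setReg : (σ.setReg x k).reg y = if y = x then k else σ.reg y := by
  simp [setReg, Function.update_apply]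

@[simp] theorem mem_setReg : (σ.setReg x k).mem = σ.mem := rfl

@[simp] theorem reg_setMem : (σ.setMem x k).reg = σ.reg := rfl

@[simp] theorem mem_setMem : (σ.setMem x k).mem y = if y = x then k else σ.mem y := by
  simp [setMem, Function.update_apply]

@[simp] theorem setReg_setReg : (σ.setReg x k).setReg x l = σ.setReg x l := by simp [setReg]

theorem setReg_comm (h : x ≠ y) : (σ.setReg x k).setReg y l = (σ.setReg y l).setReg x k := by
  simp [setReg, Function.update_comm h]

theorem setReg_eq_self (h : σ.reg x = k) : σ.setReg x k = σ := by simp [setReg, ← h]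

@[simp] theorem reg_writeSet {a : ℕ} {N : Finset (Fin n)} : (σ.writeSet a N).reg = σ.reg := rfl

theorem mem_writeSet_of_lt {a i : ℕ} {N : Finset (Fin n)} (h : i < a) :
    (σ.writeSet a N).mem i = σ.mem i := by
  simp [writeSet, h.not_ge]

@[simp] theorem readSet_writeSet {a : ℕ} {N : Finset (Fin n)} :
    (σ.writeSet a N).readSet n a = N := by
  ext s
  simp [readSet, writeSet]

theorem mem_readSet {a : ℕ} {s : Fin n} : s ∈ σ.readSet n a ↔ σ.mem (a + s) ≠ 0 := by
  simp [readSet]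

@[simp] theorem readMult_apply {a : ℕ} {s : Fin n} : σ.readMult n a s = σ.mem (a + s) := rfl

end Store

namespace Com

/-- The registers that a program may change. -/
def regs : Com → Finset ℕ
  | const x _ | add x _ _ | sub x _ _ | load x _ => {x}
  | store _ _ | net _ _ _ => ∅
  | seq p q | ifnz _ p q => p.regs ∪ q.regs
  | whilenz _ p => p.regs

/-- The program does not write to the memory, and calls no subroutine. -/
def ReadOnly : Com → Prop
  | const _ _ | add _ _ _ | sub _ _ _ | load _ _ => True
  | store _ _ | net _ _ _ => False
  | seq p q | ifnz _ p q => p.ReadOnly ∧ q.ReadOnly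
  | whilenz _ p => p.ReadOnly

/-- What the text of `P` shows to be equal in `σ` and a state `σ'` reached by running `P`. -/
structure Frame (P : Com) (σ σ' : Store) : Prop where
  reg : ∀ x ∉ P.regs, σ'.reg x = σ.reg x
  mem : P.ReadOnly → σ'.mem = σ.mem

namespace Frame

variable {P Q : Com} {σ σ' σ'' : Store}

theorem refl (P : Com) (σ : Store) : P.Frame σ σ := ⟨fun _ _ => rfl, fun _ => rfl⟩

theorem trans (h : P.Frame σ σ') (h' : P.Frame σ' σ'') : P.Frame σ σ'' :=
  ⟨fun x hx => (h'.reg x hx).trans (h.reg x hx), fun hP => (h'.mem hP).trans (h.mem hP)⟩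

theorem mono (h : P.Frame σ σ') (hregs : P.regs ⊆ Q.regs) (hmem : Q.ReadOnly → P.ReadOnly) :
    Q.Frame σ σ' :=
  ⟨fun x hx => h.reg x fun hP => hx (hregs hP), fun hQ => h.mem (hmem hQ)⟩

end Frame

end Com

section Logic

variable {U : Type u} {n : ℕ} {C : ConfigSystem.{u, 0, w} U (Fin n)} {b : ℕ} {A : ℝ}
  {F : NetFinder C b A} {𝒯 : Set ℕ} {P Q : Com} {σ : Store} {B B' : ℕ} {Post Mid : Store → Prop}

theorem Exec.frame {σ' : Store} {t : ℕ} (h : Exec F P σ σ' t) : P.Frame σ σ' := by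
  induction h with
  | const | add | sub | load =>
    exact ⟨fun y hy => by simpa [Com.regs] using fun h => absurd h (by simpa [Com.regs] using hy),
      fun _ => rfl⟩
  | store | net => exact ⟨fun _ _ => rfl, False.elim⟩
  | seq _ _ ih ih' =>
    exact (ih.mono Finset.subset_union_left And.left).trans
      (ih'.mono Finset.subset_union_right And.right)
  | if_pos _ _ ih => exact ih.mono Finset.subset_union_left And.left
  | if_neg _ _ ih => exact ih.mono Finset.subset_union_right And.right
  | while_neg => exact .refl _ _
  | while_pos _ _ _ ih ih' => exact (ih.mono (Q := .whilenz _ _) subset_rfl id).trans ih'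

/-- From `σ`, the program `P` halts in a state that satisfies `Post`, after a time that is at most
`(T + 1) * B` for all `T ∈ 𝒯`. -/
def Runs (F : NetFinder C b A) (𝒯 : Set ℕ) (P : Com) (σ : Store) (B : ℕ) (Post : Store → Prop) :
    Prop :=
  ∃ σ' t, Exec F P σ σ' t ∧ (∀ T ∈ 𝒯, t ≤ (T + 1) * B) ∧ Post σ'

namespace Runs

theorem mono (h : Runs F 𝒯 P σ B Mid) (hB : B ≤ B')
    (hPost : ∀ σ', P.Frame σ σ' → Mid σ' → Post σ') : Runs F 𝒯 P σ B' Post := by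
  obtain ⟨σ', t, hexec, htime, hmid⟩ := h
  exact ⟨σ', t, hexec, fun T hT => (htime T hT).trans (Nat.mul_le_mul_left _ hB),
    hPost σ' hexec.frame hmid⟩

theorem of_le (h : Runs F 𝒯 P σ B Post) (hB : B ≤ B') : Runs F 𝒯 P σ B' Post :=
  h.mono hB fun _ _ => id

theorem seq (h : Runs F 𝒯 P σ B Mid)
    (h' : ∀ σ', P.Frame σ σ' → Mid σ' → Runs F 𝒯 Q σ' B' Post) :
    Runs F 𝒯 (.seq P Q) σ (B + B') Post := by
  obtain ⟨σ', t, hexec, htime, hmid⟩ := h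
  obtain ⟨σ'', t', hexec', htime', hpost⟩ := h' σ' hexec.frame hmid
  refine ⟨σ'', t + t', .seq hexec hexec', fun T hT => ?_, hpost⟩
  rw [mul_add]
  exact add_le_add (htime T hT) (htime' T hT)

theorem of_step {σ' : Store} (h : Exec F P σ σ' 1) (hPost : Post σ') : Runs F 𝒯 P σ 1 Post :=
  ⟨σ', 1, h, fun _ _ => Nat.succ_le_of_lt (by positivity), hPost⟩

theorem step_seq {σ' : Store} (h : Exec F P σ σ' 1) (h' : Runs F 𝒯 Q σ' B Post) :
    Runs F 𝒯 (.seq P Q) σ (B + 1) Post := by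
  rw [add_comm]
  exact (of_step (Post := (· = σ')) h rfl).seq fun _ _ h => h ▸ h'

theorem const {x k : ℕ} (h : Post (σ.setReg x k)) : Runs F 𝒯 (.const x k) σ 1 Post :=
  of_step (.const ..) h

theorem const_seq {x k : ℕ} (h : Runs F 𝒯 Q (σ.setReg x k) B Post) :
    Runs F 𝒯 (.seq (.const x k) Q) σ (B + 1) Post := step_seq (.const ..) h

theorem add {x y z : ℕ} (h : Post (σ.setReg x (σ.reg y + σ.reg z))) :
    Runs F 𝒯 (.add x y z) σ 1 Post := of_step (.add ..) h

theorem add_seq {x y z : ℕ} (h : Runs F 𝒯 Q (σ.setReg x (σ.reg y + σ.reg z)) B Post) :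
    Runs F 𝒯 (.seq (.add x y z) Q) σ (B + 1) Post := step_seq (.add ..) h

theorem sub {x y z : ℕ} (h : Post (σ.setReg x (σ.reg y - σ.reg z))) :
    Runs F 𝒯 (.sub x y z) σ 1 Post := of_step (.sub ..) h

theorem sub_seq {x y z : ℕ} (h : Runs F 𝒯 Q (σ.setReg x (σ.reg y - σ.reg z)) B Post) :
    Runs F 𝒯 (.seq (.sub x y z) Q) σ (B + 1) Post := step_seq (.sub ..) h

theorem load_seq {x y : ℕ} (h : Runs F 𝒯 Q (σ.setReg x (σ.mem (σ.reg y))) B Post) :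
    Runs F 𝒯 (.seq (.load x y) Q) σ (B + 1) Post := step_seq (.load ..) h

theorem store {x y : ℕ} (h : Post (σ.setMem (σ.reg x) (σ.reg y))) :
    Runs F 𝒯 (.store x y) σ 1 Post := of_step (.store ..) h

theorem store_seq {x y : ℕ} (h : Runs F 𝒯 Q (σ.setMem (σ.reg x) (σ.reg y)) B Post) :
    Runs F 𝒯 (.seq (.store x y) Q) σ (B + 1) Post := step_seq (.store ..) h

open Classical in
theorem net {x y z : ℕ}
    (hcost : ∀ T ∈ 𝒯, F.cost σ.calls (σ.readMult n (σ.reg x)) (σ.reg y) ≤ T)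
    (h : Post (σ.writeSet (σ.reg z)
      ((F.find σ.calls (σ.readMult n (σ.reg x)) (σ.reg y)).image Sigma.fst))) :
    Runs F 𝒯 (.net x y z) σ (n + 2) Post :=
  ⟨_, _, .net .., fun T hT => by nlinarith [hcost T hT], h⟩

theorem ifnz {x : ℕ} (h : σ.reg x ≠ 0 → Runs F 𝒯 P σ B Post)
    (h' : σ.reg x = 0 → Runs F 𝒯 Q σ B Post) : Runs F 𝒯 (.ifnz x P Q) σ (B + 1) Post := by
  by_cases hx : σ.reg x = 0
  · obtain ⟨σ', t, hexec, htime, hpost⟩ := h' hx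
    exact ⟨σ', t + 1, .if_neg hx hexec, fun T hT => by nlinarith [htime T hT], hpost⟩
  · obtain ⟨σ', t, hexec, htime, hpost⟩ := h hx
    exact ⟨σ', t + 1, .if_pos hx hexec, fun T hT => by nlinarith [htime T hT], hpost⟩

theorem whilenz {x : ℕ} {I : ℕ → Store → Prop}
    (hbody : ∀ k σ', P.Frame σ σ' → I k σ' → σ'.reg x ≠ 0 →
      Runs F 𝒯 P σ' B fun σ'' => ∃ k' < k, I k' σ'')
    {k : ℕ} (hI : I k σ) :
    Runs F 𝒯 (.whilenz x P) σ (k * (B + 1) + 1) fun σ' => σ'.reg x = 0 ∧ ∃ k' ≤ k, I k' σ' := by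
  suffices h : ∀ k σ', P.Frame σ σ' → I k σ' → Runs F 𝒯 (.whilenz x P) σ' (k * (B + 1) + 1)
      fun σ'' => σ''.reg x = 0 ∧ ∃ k' ≤ k, I k' σ'' from h k σ (.refl P σ) hI
  intro k
  induction k using Nat.strong_induction_on with
  | _ k ih =>
    intro σ₁ hframe hI
    by_cases hx : σ₁.reg x = 0
    · exact of_le (of_step (.while_neg hx) ⟨hx, k, le_rfl, hI⟩) (Nat.le_add_left _ _)
    obtain ⟨σ₂, t, hexec, htime, k', hk', hI'⟩ := hbody k σ₁ hframe hI hx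
    obtain ⟨σ₃, t', hexec', htime', hx', k'', hk'', hI''⟩ :=
      ih k' hk' σ₂ (hframe.trans hexec.frame) hI'
    refine ⟨σ₃, t + t' + 1, .while_pos hx hexec hexec', fun T hT => ?_,
      hx', k'', hk''.trans hk'.le, hI''⟩
    calc t + t' + 1 ≤ (T + 1) * B + (T + 1) * (k' * (B + 1) + 1) + (T + 1) :=
          add_le_add (add_le_add (htime T hT) (htime' T hT)) (Nat.le_add_left _ _)
      _ = (T + 1) * ((k' + 1) * (B + 1) + 1) := by ring
      _ ≤ (T + 1) * (k * (B + 1) + 1) := by gcongr; exact hk'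

theorem whilenz_count {x N : ℕ} {J : ℕ → Store → Prop}
    (hbody : ∀ i σ', i < N → P.Frame σ σ' → J i σ' → σ'.reg x = N - i →
      Runs F 𝒯 P σ' B fun σ'' => J (i + 1) σ'' ∧ σ''.reg x = N - (i + 1))
    (hJ : J 0 σ) (hx : σ.reg x = N) : Runs F 𝒯 (.whilenz x P) σ (N * (B + 1) + 1) (J N) := by
  refine (whilenz (I := fun k σ' => ∃ i, i + k = N ∧ σ'.reg x = k ∧ J i σ')
    (fun k σ' hframe ⟨i, hik, hxk, hJi⟩ hne => ?_) ⟨0, zero_add N, hx, hJ⟩).mono le_rfl ?_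
  · rw [hxk] at hne
    refine (hbody i σ' (by omega) hframe hJi (by omega)).mono le_rfl
      fun σ'' _ ⟨hJ', hx'⟩ => ⟨k - 1, by omega, i + 1, by omega, hx'.trans (by omega), hJ'⟩
  · rintro σ' - ⟨hzero, k, -, i, hik, hxk, hJi⟩
    rwa [show i = N by rw [← hik, ← hxk, hzero, add_zero]] at hJi

end Runs

end Logic

namespace Reg

@[simp] abbrev objects : ℕ := 0
@[simp] abbrev points : ℕ := 1
@[simp] abbrev net : ℕ := 2
@[simp] abbrev one : ℕ := 3
@[simp] abbrev weights : ℕ := 4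
@[simp] abbrev maxTotal : ℕ := 5
@[simp] abbrev param : ℕ := 6
@[simp] abbrev total : ℕ := 7
@[simp] abbrev uncovered : ℕ := 8
@[simp] abbrev uncoveredRow : ℕ := 9
@[simp] abbrev row : ℕ := 10
@[simp] abbrev rowsLeft : ℕ := 11
@[simp] abbrev exposed : ℕ := 12
@[simp] abbrev colsLeft : ℕ := 13
@[simp] abbrev cellA : ℕ := 14
@[simp] abbrev cellB : ℕ := 15
@[simp] abbrev tmp : ℕ := 16

end Reg

open Reg

local notation:60 p:61 ";;" q:60 => Com.seq p q

namespace Com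

/-- Copies register `y` to register `x ≠ y`. -/
def move (x y : ℕ) : Com := const x 0 ;; add x x y

/-- Runs `p` if register `x` is not zero. -/
def ifThen (x : ℕ) (p : Com) : Com := .ifnz x p (const x 0)

/-- Adds `a * k` to register `d`, for the values `a`, `k` of two registers, and clears the
latter. -/
def mulAdd (d a k : ℕ) : Com := .whilenz k (add d d a ;; sub k k one)

/-- Runs `p` as many times as `colsLeft` says, and advances `cellA` and `cellB` after each run. -/
def colsLoop (p : Com) : Com :=
  .whilenz colsLeft (p ;; add cellA cellA one ;; add cellB cellB one ;; sub colsLeft colsLeft one)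

/-- Runs `p` once for every object, while `cellA` and `cellB` run through the `n` cells at
the addresses in `x` and `y`. -/
def forCols (x y : ℕ) (p : Com) : Com :=
  move cellA x ;; move cellB y ;; move colsLeft objects ;; colsLoop p

end Com

section Macros

variable {U : Type u} {n : ℕ} {C : ConfigSystem.{u, 0, w} U (Fin n)} {b : ℕ} {A : ℝ}
  {F : NetFinder C b A} {𝒯 : Set ℕ} {P Q : Com} {σ : Store} {B B' : ℕ} {Post Mid : Store → Prop}

namespace Runs

theorem move {x y : ℕ} (hxy : x ≠ y) (h : Post (σ.setReg x (σ.reg y))) :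
    Runs F 𝒯 (.move x y) σ 2 Post :=
  const_seq (add (by simpa [hxy.symm] using h))

theorem move_seq {x y : ℕ} (hxy : x ≠ y) (h : Runs F 𝒯 Q (σ.setReg x (σ.reg y)) B Post) :
    Runs F 𝒯 (.move x y ;; Q) σ (B + 2) Post := by
  rw [add_comm]
  exact (move (Post := (· = _)) hxy rfl).seq fun _ _ h' => h' ▸ h

theorem ifThen {x : ℕ} (h : σ.reg x ≠ 0 → Runs F 𝒯 P σ (B + 1) Post)
    (h' : σ.reg x = 0 → Post σ) : Runs F 𝒯 (.ifThen x P) σ (B + 2) Post :=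
  ifnz h fun hx => (const (by simpa only [Store.setReg_eq_self hx] using h' hx)).of_le (by omega)

theorem mulAdd {d a k : ℕ} (hne : [d, k, a].Nodup) (hne_one : one ∉ [d, k])
    (hone : σ.reg one = 1)
    (h : Post ((σ.setReg k 0).setReg d (σ.reg d + σ.reg k * σ.reg a))) :
    Runs F 𝒯 (.mulAdd d a k) σ (σ.reg k * 3 + 1) Post := by
  obtain ⟨⟨hdk, hda⟩, hka⟩ : (d ≠ k ∧ d ≠ a) ∧ k ≠ a := by simpa using hne
  obtain ⟨hd, hk⟩ : one ≠ d ∧ one ≠ k := by simpa using hne_one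
  refine (whilenz_count (N := σ.reg k) (B := 2)
    (J := fun i σ' => σ' = (σ.setReg k (σ.reg k - i)).setReg d (σ.reg d + i * σ.reg a))
    (fun i σ' _ _ hJ _ => ?_) ?_ rfl).mono le_rfl ?_
  · subst hJ
    refine add_seq (sub ⟨?_, ?_⟩)
    · simp only [Store.reg_setReg, hda.symm, hdk.symm, hka.symm, hd, hk, hone, if_true,
        if_false, Store.setReg_setReg, Nat.sub_sub, add_assoc, ← Nat.succ_mul]
      rw [Store.setReg_comm hdk, Store.setReg_setReg]
    · simp [hdk.symm, hd, hk, hone, Nat.sub_sub]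
  · simp [Store.setReg_eq_self]
  · rintro _ - rfl
    simpa using h

theorem mulAdd_seq {d a k : ℕ} (hne : [d, k, a].Nodup) (hne_one : one ∉ [d, k])
    (hone : σ.reg one = 1)
    (h : Runs F 𝒯 Q ((σ.setReg k 0).setReg d (σ.reg d + σ.reg k * σ.reg a)) B Post) :
    Runs F 𝒯 (.mulAdd d a k ;; Q) σ (B + (σ.reg k * 3 + 1)) Post := by
  rw [add_comm B]
  exact (mulAdd (Post := (· = _)) hne hne_one hone rfl).seq fun _ _ h' => h' ▸ h

theorem colsLoop {k l acc : ℕ} {J : Finset (Fin n) → ℕ → (ℕ → ℕ) → Prop}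
    (hleft : σ.reg colsLeft = n) (hA : σ.reg cellA = k) (hB : σ.reg cellB = l)
    (hone : σ.reg one = 1) (hacc : acc ∉ ({colsLeft, cellA, cellB} : Finset ℕ))
    (hP : Disjoint P.regs {one, colsLeft, cellA, cellB}) (hJ : J ∅ (σ.reg acc) σ.mem)
    (hbody : ∀ (s : Fin n) (S : Finset (Fin n)) (σ' : Store), s ∉ S →
      (Com.colsLoop P).Frame σ σ' → σ'.reg cellA = k + s → σ'.reg cellB = l + s →
      J S (σ'.reg acc) σ'.mem →
      Runs F 𝒯 P σ' B fun σ'' => J (insert s S) (σ''.reg acc) σ''.mem) :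
    Runs F 𝒯 (.colsLoop P) σ (n * (B + 4) + 1) fun σ' =>
      J Finset.univ (σ'.reg acc) σ'.mem := by
  have hcontrol : ∀ z ∈ ({one, colsLeft, cellA, cellB} : Finset ℕ), z ∉ P.regs :=
    fun z hz hzP => Finset.disjoint_left.mp hP hzP hz
  simp only [Finset.mem_insert, Finset.mem_singleton, not_or] at hacc
  refine (whilenz_count (N := n) (B := B + 3) (J := fun i σ' =>
    σ'.reg cellA = k + i ∧ σ'.reg cellB = l + i ∧ J {s : Fin n | s.val < i} (σ'.reg acc) σ'.mem)
    (fun i σ' hi hframe ⟨hA, hB, hJ⟩ hleft => ?_) ⟨hA, hB, by simpa using hJ⟩ hleft).mono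
    le_rfl fun σ' _ ⟨_, _, hJ⟩ => by simpa using hJ
  have hinsert : ({s | s.val < i + 1} : Finset (Fin n)) =
      insert ⟨i, hi⟩ ({s | s.val < i} : Finset (Fin n)) := by
    ext s
    simp only [Finset.mem_insert, Finset.mem_filter_univ, Fin.ext_iff]
    omega
  have hone' : σ'.reg one = 1 := by
    rw [hframe.reg one (by simpa [Com.regs] using hcontrol one (by simp)), hone]
  refine (hbody ⟨i, hi⟩ _ σ' (by simp) (hframe.mono (Q := .colsLoop P) subset_rfl id)
    hA hB hJ).seq fun σ'' hbodyFrame hJ' => add_seq (add_seq (sub ?_))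
  have hsame : ∀ z ∈ ({one, colsLeft, cellA, cellB} : Finset ℕ), σ''.reg z = σ'.reg z :=
    fun z hz => hbodyFrame.reg z (hcontrol z hz)
  rw [← hinsert] at hJ'
  simpa [hacc, hsame, hone', hA, hB, hleft, add_assoc, Nat.sub_sub] using hJ'

theorem forCols {x y acc : ℕ} {J : Finset (Fin n) → ℕ → (ℕ → ℕ) → Prop}
    (hn : σ.reg objects = n) (hone : σ.reg one = 1)
    (hacc : acc ∉ ({colsLeft, cellA, cellB} : Finset ℕ))
    (hx : x ∉ ({colsLeft, cellA, cellB} : Finset ℕ))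
    (hy : y ∉ ({colsLeft, cellA, cellB} : Finset ℕ))
    (hP : Disjoint P.regs {one, colsLeft, cellA, cellB}) (hJ : J ∅ (σ.reg acc) σ.mem)
    (hbody : ∀ (s : Fin n) (S : Finset (Fin n)) (σ' : Store), s ∉ S →
      (Com.forCols x y P).Frame σ σ' → σ'.reg cellA = σ.reg x + s → σ'.reg cellB = σ.reg y + s →
      J S (σ'.reg acc) σ'.mem →
      Runs F 𝒯 P σ' B fun σ'' => J (insert s S) (σ''.reg acc) σ''.mem) :
    Runs F 𝒯 (.forCols x y P) σ (n * (B + 4) + 7) fun σ' =>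
      J Finset.univ (σ'.reg acc) σ'.mem := by
  simp only [Finset.mem_insert, Finset.mem_singleton, not_or] at hacc hx hy
  refine move_seq (Ne.symm hx.2.1) (move_seq (Ne.symm hy.2.2) (move_seq (by simp) ?_))
  set τ := ((σ.setReg cellA (σ.reg x)).setReg cellB _).setReg colsLeft _ with hτ
  have hframe : (Com.forCols x y P).Frame σ τ := by
    refine ⟨fun z hz => ?_, fun _ => rfl⟩
    simp only [Com.forCols, Com.move, Com.regs, Finset.mem_union, Finset.mem_singleton,
      not_or] at hz
    simp [hτ, hz]
  refine colsLoop (k := σ.reg x) (l := σ.reg y) (by simp [hτ, hn]) (by simp [hτ])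
    (by simp [hτ, hy]) (by simp [hτ, hone]) (by simpa using hacc) hP (by simpa [hτ, hacc] using hJ)
    fun s S σ' hs hloop => hbody s S σ' hs (hframe.trans (hloop.mono (fun z hz => ?_) fun h => ?_))
  · simp [Com.forCols, Com.regs, hz]
  · exact h.2.2.2

end Runs

end Macros

namespace Com

/-- Increases the parameter by `4`, and sets all weights to `L`. -/
def resetWeights (L : ℕ) : Com :=
  const tmp 4 ;; add param param tmp ;; const total 0 ;;
  forCols weights weights (const tmp L ;; store cellA tmp ;; add total total tmp)

/-- Clears `exposed` if the object of the current column contains the point of the current row,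
and belongs to the net. -/
def scanCell : Com :=
  load tmp cellB ;; ifThen tmp (load tmp cellA ;; ifThen tmp (const exposed 0))

/-- Checks if the net covers the point of the current row, and goes on to the next row. -/
def scanRow : Com :=
  const exposed 1 ;; forCols Reg.net row scanCell ;;
  ifThen exposed (const uncovered 1 ;; move uncoveredRow row) ;;
  add row row objects ;; sub rowsLeft rowsLeft one

/-- Looks for a point that the net does not cover. -/
def scan : Com :=
  const uncovered 0 ;; const row 0 ;; move rowsLeft points ;; .whilenz rowsLeft scanRow

/-- Doubles the weight of the object of the current column if it contains the uncovered point. -/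
def doubleCell : Com :=
  load tmp cellB ;;
  ifThen tmp (load tmp cellA ;; add total total tmp ;; add tmp tmp tmp ;; store cellA tmp)

/-- Doubles the weights of the objects that contain the uncovered point. -/
def double : Com := forCols weights uncoveredRow doubleCell

/-- Starts again with a larger parameter if the total weight has become too large. -/
def checkWeight (L : ℕ) : Com := sub tmp total maxTotal ;; ifThen tmp (resetWeights L)

/-- One round: builds a net, and doubles the weights of the objects that contain a point that the
net does not cover. -/
def reweight (L : ℕ) : Com :=
  net weights param Reg.net ;; scan ;; ifThen uncovered (double ;; checkWeight L)

/-- The memory holds the incidence matrix, then the weights, then the net. Multiplication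
is replaced by repeated addition. -/
def setUp (b L : ℕ) : Com :=
  const one 1 ;; move tmp points ;; mulAdd weights objects tmp ;; add Reg.net weights objects ;;
  move tmp objects ;; mulAdd row objects tmp ;; const tmp L ;; mulAdd maxTotal row tmp ;;
  const param (2 * b) ;; move uncovered points

/-- Covers the points by the sets of the net, in rounds of reweighting with start weight `L`. -/
def cover (b L : ℕ) : Com :=
  setUp b L ;; ifThen uncovered (resetWeights L ;; .whilenz uncovered (reweight L))

end Com

/-- The incidence matrix with rows `pts` is in memory, and the constant registers have
their values. -/
structure Store.IsSetUp {n : ℕ} (L : ℕ) (pts : List (Finset (Fin n))) (σ : Store) : Prop where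
  objects : σ.reg Reg.objects = n
  points : σ.reg Reg.points = pts.length
  net : σ.reg Reg.net = pts.length * n + n
  one : σ.reg Reg.one = 1
  weights : σ.reg Reg.weights = pts.length * n
  maxTotal : σ.reg Reg.maxTotal = L * (n * n)
  row : ∀ j (hj : j < pts.length), σ.readSet n (j * n) = pts[j]

section Procedures

variable {U : Type u} {n : ℕ} {C : ConfigSystem.{u, 0, w} U (Fin n)} {b : ℕ} {A : ℝ}
  {F : NetFinder C b A} {𝒯 : Set ℕ} {σ σ' : Store} {L : ℕ} {pts : List (Finset (Fin n))}

theorem Store.row_add_lt {j : ℕ} (hj : j < pts.length) (s : Fin n) :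
    j * n + s < pts.length * n := by
  calc j * n + s < (j + 1) * n := by rw [add_one_mul]; exact Nat.add_lt_add_left s.2 _
    _ ≤ pts.length * n := Nat.mul_le_mul_right n hj

theorem Store.IsSetUp.of_frame {P : Com} (h : σ.IsSetUp L pts) (hframe : P.Frame σ σ')
    (hregs : ∀ x ∈ P.regs, Reg.maxTotal < x) (hmem : ∀ i < pts.length * n, σ'.mem i = σ.mem i) :
    σ'.IsSetUp L pts := by
  have hreg : ∀ x ≤ Reg.maxTotal, σ'.reg x = σ.reg x :=
    fun x hx => hframe.reg x fun hP => (hregs x hP).not_ge hx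
  refine ⟨?_, ?_, ?_, ?_, ?_, ?_, fun j hj => ?_⟩
  · rw [hreg _ (by simp), h.objects]
  · rw [hreg _ (by simp), h.points]
  · rw [hreg _ (by simp), h.net]
  · rw [hreg _ (by simp), h.one]
  · rw [hreg _ (by simp), h.weights]
  · rw [hreg _ (by simp), h.maxTotal]
  · rw [← h.row j hj]
    ext s
    rw [Store.mem_readSet, Store.mem_readSet, hmem _ (Store.row_add_lt hj s)]

theorem Store.IsSetUp.setReg {x k : ℕ} (h : σ.IsSetUp L pts) (hx : Reg.maxTotal < x) :
    (σ.setReg x k).IsSetUp L pts :=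
  h.of_frame (P := .const x k) ⟨fun y hy => by simp_all [Com.regs], fun _ => rfl⟩
    (by simpa [Com.regs] using hx) fun _ _ => rfl

theorem runs_forCols_weights {y B : ℕ} {P : Com} {wt δ : Fin n → ℕ} (hσ : σ.IsSetUp L pts)
    (hy : y ∉ ({colsLeft, cellA, cellB} : Finset ℕ))
    (hP : Disjoint P.regs {one, colsLeft, cellA, cellB})
    (hbody : ∀ (s : Fin n) (σ' : Store), (Com.forCols weights y P).Frame σ σ' →
      σ'.reg cellA = pts.length * n + s → σ'.reg cellB = σ.reg y + s →
      (∀ i < pts.length * n, σ'.mem i = σ.mem i) →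
      σ'.mem (pts.length * n + s) = σ.mem (pts.length * n + s) →
      Runs F 𝒯 P σ' B fun σ'' => σ''.reg total = σ'.reg total + δ s ∧
        σ''.mem = Function.update σ'.mem (pts.length * n + s) (wt s)) :
    Runs F 𝒯 (.forCols weights y P) σ (n * (B + 4) + 7) fun σ' =>
      σ'.reg total = σ.reg total + ∑ s, δ s ∧ (∀ i < pts.length * n, σ'.mem i = σ.mem i) ∧
      σ'.readMult n (pts.length * n) = wt := by
  refine (Runs.forCols (acc := total) (J := fun S W mem => W = σ.reg total + ∑ s ∈ S, δ s ∧
    (∀ i < pts.length * n, mem i = σ.mem i) ∧ ∀ s : Fin n, mem (pts.length * n + s) =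
      if s ∈ S then wt s else σ.mem (pts.length * n + s))
    hσ.objects hσ.one (by decide) (by decide) hy hP (by simp)
    fun s S σ' hs hframe hA hB ⟨hW, hmem, hwt⟩ => ?_).mono le_rfl
      fun σ' _ ⟨hW, hmem, hwt⟩ => ⟨hW, hmem, funext fun s => by simpa using hwt s⟩
  rw [hσ.weights] at hA
  refine (hbody s σ' hframe hA hB hmem (by simp [hwt, hs])).mono le_rfl
    fun σ'' _ ⟨hW'', hmem'⟩ => ?_
  rw [hW'', hW, hmem', Finset.sum_insert hs]
  refine ⟨by ring, fun i hi => ?_, fun s' => ?_⟩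
  · rw [Function.update_of_ne (by omega), hmem i hi]
  · by_cases h : s' = s
    · simp [h]
    · have hne : pts.length * n + s' ≠ pts.length * n + s := by omega
      rw [Function.update_of_ne hne, hwt]
      simp [h]

theorem runs_resetWeights (hσ : σ.IsSetUp L pts) :
    Runs F 𝒯 (.resetWeights L) σ (n * 7 + 10) fun σ' =>
      σ'.IsSetUp L pts ∧ σ'.reg param = σ.reg param + 4 ∧ σ'.reg total = L * n ∧
      σ'.readMult n (pts.length * n) = fun _ => L := by
  suffices Runs F 𝒯 (.resetWeights L) σ (n * 7 + 10) fun σ' =>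
      σ'.reg param = σ.reg param + 4 ∧ σ'.reg total = L * n ∧
      (∀ i < pts.length * n, σ'.mem i = σ.mem i) ∧
      σ'.readMult n (pts.length * n) = fun _ => L from
    this.mono le_rfl fun σ' hframe ⟨hparam, htotal, hmem, hwt⟩ => ⟨hσ.of_frame hframe
      (by simp [Com.resetWeights, Com.forCols, Com.colsLoop, Com.move, Com.regs]) hmem,
      hparam, htotal, hwt⟩
  refine Runs.const_seq (Runs.add_seq (Runs.const_seq ?_))
  set τ := ((σ.setReg tmp 4).setReg param _).setReg total 0 with hτ
  have hset : τ.IsSetUp L pts :=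
    ((hσ.setReg (by decide)).setReg (by decide)).setReg (by decide)
  refine (runs_forCols_weights (δ := fun _ => L) hset (by decide) (by simp [Com.regs])
    fun s σ' _ hA _ _ _ => Runs.const_seq (Runs.store_seq (Runs.add ?_))).mono le_rfl
      fun σ' hframe ⟨htotal, hmem, hwt⟩ => ⟨?_, ?_, hmem, hwt⟩
  · simp [hA, Store.setMem]
  · rw [hframe.reg param (by simp [Com.forCols, Com.colsLoop, Com.move, Com.regs])]
    simp [hτ]
  · simp [htotal, hτ, mul_comm]

theorem runs_double {j : ℕ} (hσ : σ.IsSetUp L pts) (hj : j < pts.length)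
    (hrow : σ.reg uncoveredRow = j * n) :
    Runs F 𝒯 .double σ (n * 10 + 7) fun σ' =>
      σ'.IsSetUp L pts ∧
      σ'.reg total = σ.reg total + ∑ s ∈ pts[j], σ.readMult n (pts.length * n) s ∧
      σ'.readMult n (pts.length * n) = fun s =>
        if s ∈ pts[j] then 2 * σ.readMult n (pts.length * n) s
        else σ.readMult n (pts.length * n) s := by
  refine (runs_forCols_weights
    (δ := fun s => if s ∈ pts[j] then σ.readMult n (pts.length * n) s else 0)
    hσ (by decide) (by decide) fun s σ' _ hA hB hmem hcell => ?_).mono le_rfl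
      fun σ' hframe ⟨htotal, hmem, hwt⟩ =>
        ⟨hσ.of_frame hframe (by decide) hmem, by simpa using htotal, hwt⟩
  rw [hrow] at hB
  have hbit : σ'.mem (j * n + s) ≠ 0 ↔ s ∈ pts[j] := by
    rw [hmem _ (Store.row_add_lt hj s), ← Store.mem_readSet, hσ.row]
  refine Runs.load_seq (Runs.ifThen (B := 3) (fun h => ?_) fun h => ?_)
  · have hs : s ∈ pts[j] := by simpa [hB, hbit] using h
    refine Runs.load_seq (Runs.add_seq (Runs.add_seq (Runs.store ?_)))
    simp [hA, hs, hcell, Store.setMem, Store.readMult_apply, two_mul]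
  · have hs : s ∉ pts[j] := by simpa [hB, ← hbit] using h
    simp [hs, Store.readMult_apply, ← hcell]

theorem Store.IsSetUp.of_readOnly_frame {P : Com} (h : σ.IsSetUp L pts) (hframe : P.Frame σ σ')
    (hregs : ∀ x ∈ P.regs, Reg.maxTotal < x) (hP : P.ReadOnly) : σ'.IsSetUp L pts :=
  h.of_frame hframe hregs fun _ _ => congrFun (hframe.mem hP) _

theorem readOnly_scanRow : Com.scanRow.ReadOnly := by
  simp [Com.scanRow, Com.scanCell, Com.forCols, Com.colsLoop, Com.ifThen, Com.move, Com.ReadOnly]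

theorem runs_forCols_scanCell {j : ℕ} (hσ : σ.IsSetUp L pts) (hj : j < pts.length)
    (hrow : σ.reg row = j * n) (hexposed : σ.reg exposed = 1) :
    Runs F 𝒯 (.forCols Reg.net row .scanCell) σ (n * 9 + 7) fun σ' =>
      σ'.reg exposed ≠ 0 ↔ Disjoint pts[j] (σ.readSet n (pts.length * n + n)) := by
  set N := σ.readSet n (pts.length * n + n) with hN
  refine (Runs.forCols (acc := exposed)
    (J := fun S e _ => e ≠ 0 ↔ ∀ s ∈ S, s ∈ pts[j] → s ∉ N)
    hσ.objects hσ.one (by decide) (by decide) (by decide) (by decide) (by simp [hexposed])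
    fun s S σ' _ hframe hA hB hJ => ?_).mono le_rfl
      fun σ' _ hJ => by simpa [Finset.disjoint_left] using hJ
  have hmem : σ'.mem = σ.mem := hframe.mem <| by
    simp [Com.scanCell, Com.forCols, Com.colsLoop, Com.ifThen, Com.move, Com.ReadOnly]
  have hpoint : σ'.mem (σ'.reg cellB) ≠ 0 ↔ s ∈ pts[j] := by
    rw [hB, hrow, hmem, ← Store.mem_readSet, hσ.row]
  have hnet : σ'.mem (σ'.reg cellA) ≠ 0 ↔ s ∈ N := by
    rw [hA, hσ.net, hmem, hN, Store.mem_readSet]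
  refine Runs.load_seq (Runs.ifThen (B := 2) (fun h => ?_) fun h => ?_)
  · have hs : s ∈ pts[j] := by simpa [← hpoint] using h
    refine Runs.load_seq (Runs.ifThen (B := 0) (fun h => Runs.const ?_) fun h => ?_)
    · have hsN : s ∈ N := by simpa [← hnet] using h
      simp [hs, hsN]
    · have hsN : s ∉ N := by simpa [← hnet] using h
      simp [hsN, hJ]
  · have hs : s ∉ pts[j] := by simpa [← hpoint] using h
    simp [hs, hJ]

theorem runs_scanRow {j : ℕ} (hσ : σ.IsSetUp L pts) (hj : j < pts.length)
    (hrow : σ.reg row = j * n) :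
    Runs F 𝒯 .scanRow σ (n * 9 + 14) fun σ' =>
      σ'.reg row = (j + 1) * n ∧ σ'.reg rowsLeft = σ.reg rowsLeft - 1 ∧
      (Disjoint pts[j] (σ.readSet n (pts.length * n + n)) ∧
        σ'.reg uncovered = 1 ∧ σ'.reg uncoveredRow = j * n ∨
      ¬Disjoint pts[j] (σ.readSet n (pts.length * n + n)) ∧
        σ'.reg uncovered = σ.reg uncovered ∧ σ'.reg uncoveredRow = σ.reg uncoveredRow) := by
  refine (Runs.const_seq ((runs_forCols_scanCell (j := j) (hσ.setReg (by decide)) hj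
    (by simpa using hrow) (by simp)).seq (B' := 6) fun σ' hframe hexposed => ?_)).of_le (by omega)
  have hreg : ∀ x ∈ ({objects, one, uncovered, uncoveredRow, row, rowsLeft} : Finset ℕ),
      σ'.reg x = σ.reg x := fun x hx => by
    have hx' : x ∉ (Com.forCols Reg.net row .scanCell).regs ∧ x ≠ exposed := by
      revert hx; revert x; decide
    rw [hframe.reg x hx'.1, Store.reg_setReg, if_neg hx'.2]
  rw [show (σ.setReg exposed 1).readSet n = σ.readSet n from rfl] at hexposed
  refine Runs.seq (Mid := fun σ'' =>
      Disjoint pts[j] (σ.readSet n (pts.length * n + n)) ∧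
        σ''.reg uncovered = 1 ∧ σ''.reg uncoveredRow = j * n ∨
      ¬Disjoint pts[j] (σ.readSet n (pts.length * n + n)) ∧
        σ''.reg uncovered = σ.reg uncovered ∧ σ''.reg uncoveredRow = σ.reg uncoveredRow)
    (Runs.ifThen (B := 2) (fun h => Runs.const_seq (Runs.move (by decide) (.inl ?_)))
      fun h => .inr ?_)
    fun σ'' hframe' hmark => Runs.add_seq (Runs.sub ?_)
  · exact ⟨hexposed.mp h, by simp, by simp [hreg, hrow]⟩
  · exact ⟨by simpa [h] using hexposed, by simp [hreg], by simp [hreg]⟩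
  · have hreg' : ∀ x ∈ ({objects, one, row, rowsLeft} : Finset ℕ), σ''.reg x = σ.reg x :=
      fun x hx => by
        rw [hframe'.reg x (by revert hx; revert x; decide), hreg x (by revert hx; revert x; decide)]
    simpa [hreg', hrow, hσ.objects, hσ.one, add_one_mul] using hmark

theorem runs_scan (hσ : σ.IsSetUp L pts) :
    Runs F 𝒯 .scan σ (pts.length * (n * 9 + 15) + 5) fun σ' =>
      (σ'.reg uncovered = 0 ∧ ∀ t ∈ pts, ¬Disjoint t (σ.readSet n (pts.length * n + n))) ∨
      (σ'.reg uncovered = 1 ∧ ∃ (j : ℕ) (hj : j < pts.length), σ'.reg uncoveredRow = j * n ∧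
        Disjoint pts[j] (σ.readSet n (pts.length * n + n))) := by
  set N := σ.readSet n (pts.length * n + n) with hN
  refine Runs.const_seq (Runs.const_seq (Runs.move_seq (by decide) ?_))
  set τ := ((σ.setReg uncovered 0).setReg row 0).setReg rowsLeft _ with hτ
  have hset : τ.IsSetUp L pts :=
    ((hσ.setReg (by decide)).setReg (by decide)).setReg (by decide)
  refine (Runs.whilenz_count (N := pts.length) (J := fun i σ' => σ'.reg row = i * n ∧
    ((σ'.reg uncovered = 0 ∧ ∀ j (hj : j < pts.length), j < i → ¬Disjoint pts[j] N) ∨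
      (σ'.reg uncovered = 1 ∧ ∃ (j : ℕ) (hj : j < pts.length), σ'.reg uncoveredRow = j * n ∧
        Disjoint pts[j] N)))
    (fun i σ' hi hframe ⟨hrow, hJ⟩ hleft => ?_)
    ⟨by simp [hτ], .inl ⟨by simp [hτ], by simp⟩⟩ (by simp [hτ, hσ.points])).mono le_rfl
      fun σ' _ ⟨_, h⟩ => h.imp_left fun ⟨h0, h⟩ => ⟨h0, fun t ht => ?_⟩
  · have hN' : σ'.readSet n (pts.length * n + n) = N := by
      rw [hN, Store.readSet, hframe.mem readOnly_scanRow]; rfl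
    refine (runs_scanRow (hset.of_readOnly_frame hframe (by decide) readOnly_scanRow) hi hrow).mono
      le_rfl fun σ'' _ ⟨hrow', hleft', hmark⟩ =>
        ⟨⟨hrow', ?_⟩, by rw [hleft', hleft, Nat.sub_sub]⟩
    rw [hN'] at hmark
    obtain ⟨hdisj, hu, hur⟩ | ⟨hmeet, hu, hur⟩ := hmark
    · exact .inr ⟨hu, i, hi, hur, hdisj⟩
    · rw [hu, hur]
      refine hJ.imp_left fun ⟨h0, h⟩ => ⟨h0, fun j hj hji => ?_⟩
      obtain hlt | rfl := Nat.lt_succ_iff_lt_or_eq.mp hji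
      exacts [h j hj hlt, hmeet]
  · obtain ⟨j, hj, rfl⟩ := List.mem_iff_getElem.mp ht
    exact h j hj hj

theorem runs_checkWeight (hσ : σ.IsSetUp L pts) :
    Runs F 𝒯 (.checkWeight L) σ (n * 7 + 12) fun σ' => σ'.IsSetUp L pts ∧
      (σ.reg total ≤ L * (n * n) ∧ σ'.reg param = σ.reg param ∧ σ'.reg total = σ.reg total ∧
        σ'.mem = σ.mem ∨
      L * (n * n) < σ.reg total ∧ σ'.reg param = σ.reg param + 4 ∧ σ'.reg total = L * n ∧
        σ'.readMult n (pts.length * n) = fun _ => L) := by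
  refine Runs.sub_seq (Runs.ifThen (B := n * 7 + 9) (fun h => ?_) fun h => ?_)
  · refine (runs_resetWeights (hσ.setReg (by decide))).mono le_rfl
      fun σ' _ ⟨hset, hparam, htotal, hwt⟩ => ⟨hset, .inr ⟨?_, by simpa using hparam, htotal, hwt⟩⟩
    simpa [hσ.maxTotal, Nat.sub_eq_zero_iff_le] using h
  · refine ⟨hσ.setReg (by decide), .inl ⟨?_, by simp, by simp, by simp⟩⟩
    simpa [hσ.maxTotal, Nat.sub_eq_zero_iff_le] using h

theorem Store.readSet_input (pts : List (Finset (Fin n))) {j : ℕ} (hj : j < pts.length) :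
    (Store.input pts).readSet n (j * n) = pts[j] := by
  ext s
  simp only [Store.mem_readSet, Store.input, ne_eq, ite_eq_right_iff, one_ne_zero, imp_false,
    not_not]
  refine ⟨?_, fun hs => ⟨⟨j, hj⟩, s, rfl, hs⟩⟩
  rintro ⟨j', s', h, hs'⟩
  have hcode : finProdFinEquiv (⟨j, hj⟩, s) = finProdFinEquiv (j', s') :=
    Fin.ext (by simpa [add_comm, mul_comm] using h)
  obtain ⟨rfl, rfl⟩ := Prod.mk.inj (finProdFinEquiv.injective hcode)
  exact hs'

theorem runs_setUp (b L : ℕ) (pts : List (Finset (Fin n))) :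
    Runs F 𝒯 (.setUp b L) (Store.input pts) (pts.length * 3 + n * 3 + L * 3 + 13) fun σ =>
      σ.IsSetUp L pts ∧ σ.reg param = 2 * b ∧ σ.reg uncovered = pts.length ∧
      σ.mem = (Store.input pts).mem := by
  have hinput : ∀ x, (Store.input pts).reg x =
      if x = 0 then n else if x = 1 then pts.length else 0 := fun _ => rfl
  refine Runs.of_le (Runs.const_seq (Runs.move_seq (by decide)
    (Runs.mulAdd_seq (by decide) (by decide) (by simp) (Runs.add_seq (Runs.move_seq (by decide)
    (Runs.mulAdd_seq (by decide) (by decide) (by simp) (Runs.const_seq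
    (Runs.mulAdd_seq (by decide) (by decide) (by simp) (Runs.const_seq
    (Runs.move (by decide) ?_)))))))))) ?_
  · refine ⟨⟨?_, ?_, ?_, ?_, ?_, ?_, fun j hj => ?_⟩, ?_, ?_, ?_⟩
    case refine_7 => exact Store.readSet_input pts hj
    all_goals simp [hinput]
  · simp [hinput]
    omega

end Procedures

section Cover

variable {U : Type u} {n : ℕ} {C : ConfigSystem.{u, 0, w} U (Fin n)} {b : ℕ} {A : ℝ}
  {F : NetFinder C b A} {𝒯 : Set ℕ} {M : Set U} {pts : List (Finset (Fin n))}
  {H N : Finset (Fin n)} {c : ℕ} {σ σ' : Store}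

theorem ConfigSystem.Lists.isCover_iff (hM : C.Lists M pts) :
    C.IsCover M N ↔ ∀ t ∈ pts, ¬Disjoint t N := by
  classical
  refine ⟨fun h t ht => ?_, fun h p hp => ?_⟩
  · obtain ⟨p, hp, hpt⟩ := (hM.2 t).mp ht
    obtain ⟨s, hs, hps⟩ := h p hp
    exact Finset.not_disjoint_iff.mpr ⟨s, (hpt s).mpr hps, hs⟩
  · obtain ⟨s, hst, hsN⟩ := Finset.not_disjoint_iff.mp <|
      h {s | p ∈ C.obj s} ((hM.2 _).mpr ⟨p, hp, by simp⟩)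
    exact ⟨s, hsN, by simpa using hst⟩

/-- All times that bound the time of each call of the net finder with a parameter at most `R` and
at most `w` objects. -/
def NetFinder.TimeBounds (F : NetFinder C b A) (R w : ℕ) : Set ℕ :=
  {T | ∀ (j : ℕ) (m : Fin n → ℕ) (r : ℕ), 1 ≤ r → 2 * b ≤ r → r ≤ ∑ s, m s → r ≤ R →
    ∑ s, m s ≤ w → F.cost j m r ≤ T}

/-- The initial weight of each object. A search for a cover with `c` sets uses nets with
parameter at most `startWeight b * c`, and this is at most the initial total weight. -/
def startWeight (b : ℕ) : ℕ := 4 + 2 * b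

/-- `N` is a cover of the size of a net whose parameter is `O(c)`. -/
def ConfigSystem.IsNetSizeCover (C : ConfigSystem.{u, 0, w} U (Fin n)) (b : ℕ) (A : ℝ) (M : Set U)
    (c : ℕ) (N : Finset (Fin n)) : Prop :=
  C.IsCover M N ∧ ∃ r ≤ startWeight b * c, (N.card : ℝ) ≤ |A| * max 1 (C.f r)

theorem ConfigSystem.IsNetSizeCover.card_le {D : ℕ} (h : C.IsNetSizeCover b A M c N)
    (hb : C.DefinedByAtMost b) (hD : C.DefinesAtMost D) :
    (N.card : ℝ) ≤ |A| * growthFactor b D (startWeight b) * max 1 (C.f c) := by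
  obtain ⟨-, r, hr, hN⟩ := h
  rw [mul_assoc]
  exact hN.trans (mul_le_mul_of_nonneg_left (max_one_f_le_mul hb hD hr) (abs_nonneg A))

/-- The main loop searches for a cover, under the assumption that `c` of the elements of the
cover `H` suffice. -/
structure Searching (b : ℕ) (pts : List (Finset (Fin n))) (H : Finset (Fin n)) (c : ℕ)
    (σ : Store) : Prop where
  isSetUp : σ.IsSetUp (startWeight b) pts
  param_eq : σ.reg param = 4 * c + 2 * b
  total_eq : σ.reg total = ∑ s, σ.readMult n (pts.length * n) s
  total_le : σ.reg total ≤ startWeight b * (n * n)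
  one_le : 1 ≤ c
  le_card : c ≤ H.card
  reweighted : Reweighted (startWeight b) (4 * c + 2 * b) H (σ.readMult n (pts.length * n))

namespace Searching

theorem start (hσ : σ.IsSetUp (startWeight b) pts) (hparam : σ.reg param = 4 * c + 2 * b)
    (htotal : σ.reg total = startWeight b * n)
    (hwt : σ.readMult n (pts.length * n) = fun _ => startWeight b) (hc : 1 ≤ c)
    (hcH : c ≤ H.card) : Searching b pts H c σ where
  isSetUp := hσ
  param_eq := hparam
  total_eq := by rw [htotal, hwt]; simp [mul_comm]
  total_le := htotal.trans_le (Nat.mul_le_mul_left _ n.le_mul_self)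
  one_le := hc
  le_card := hcH
  reweighted := hwt ▸ .start _ _ _

theorem of_frame {P : Com} (h : Searching b pts H c σ) (hframe : P.Frame σ σ')
    (hregs : ∀ x ∈ P.regs, Reg.total < x)
    (hmem : ∀ i < pts.length * n + n, σ'.mem i = σ.mem i) : Searching b pts H c σ' := by
  have hreg : ∀ x ≤ Reg.total, σ'.reg x = σ.reg x :=
    fun x hx => hframe.reg x fun hP => (hregs x hP).not_ge hx
  have hwt : σ'.readMult n (pts.length * n) = σ.readMult n (pts.length * n) :=
    funext fun s => hmem _ (Nat.add_lt_add_left s.2 _)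
  exact
    { isSetUp := h.isSetUp.of_frame hframe (fun x hx => lt_trans (by decide) (hregs x hx))
        fun i hi => hmem i (Nat.lt_add_right n hi)
      param_eq := by rw [hreg _ (by decide), h.param_eq]
      total_eq := by rw [hreg _ le_rfl, hwt, h.total_eq]
      total_le := by rw [hreg _ le_rfl]; exact h.total_le
      one_le := h.one_le
      le_card := h.le_card
      reweighted := hwt ▸ h.reweighted }

theorem param_le (h : Searching b pts H c σ) : 4 * c + 2 * b ≤ startWeight b * H.card := by
  have := h.one_le
  have := h.le_card
  rw [startWeight]
  nlinarith

theorem param_le_sum (h : Searching b pts H c σ) :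
    4 * c + 2 * b ≤ ∑ s, σ.readMult n (pts.length * n) s := by
  calc 4 * c + 2 * b ≤ startWeight b * Fintype.card (Fin n) :=
        h.param_le.trans (Nat.mul_le_mul_left _ H.card_le_univ)
    _ ≤ _ := h.reweighted.mul_card_le

theorem runs_net (h : Searching b pts H c σ) :
    Runs F (F.TimeBounds (startWeight b * H.card) (startWeight b * (n * n)))
      (.net weights param Reg.net) σ (n + 2) fun σ' => Searching b pts H c σ' ∧
        ((σ'.readSet n (pts.length * n + n)).card : ℝ) ≤ A * max 1 (C.f (4 * c + 2 * b)) ∧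
        ∀ (p : U) (t : Finset (Fin n)), (∀ s, s ∈ t ↔ p ∈ C.obj s) →
          Disjoint t (σ'.readSet n (pts.length * n + n)) →
          (4 * c + 2 * b) * ∑ s ∈ t, σ'.readMult n (pts.length * n) s ≤
            ∑ s, σ'.readMult n (pts.length * n) s := by
  have hone : 1 ≤ 4 * c + 2 * b := by have := h.one_le; omega
  have hb : 2 * b ≤ 4 * c + 2 * b := Nat.le_add_left _ _
  refine (Runs.net (Post := fun σ' => σ' = _) (fun T hT => ?_) rfl).mono le_rfl
    fun σ' hframe hσ' => ?_
  · rw [h.isSetUp.weights, h.param_eq]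
    exact hT _ _ _ hone hb h.param_le_sum h.param_le (h.total_eq ▸ h.total_le)
  · rw [h.isSetUp.weights, h.param_eq, h.isSetUp.net] at hσ'
    have hmem : ∀ i < pts.length * n + n, σ'.mem i = σ.mem i :=
      fun i hi => by rw [hσ', Store.mem_writeSet_of_lt hi]
    have hwt : σ'.readMult n (pts.length * n) = σ.readMult n (pts.length * n) :=
      funext fun s => hmem _ (Nat.add_lt_add_left s.2 _)
    refine ⟨h.of_frame hframe (by simp [Com.regs]) hmem, ?_, fun p t ht hdisj => ?_⟩
    · rw [hσ', Store.readSet_writeSet]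
      exact (Nat.cast_le.mpr Finset.card_image_le).trans (F.card_le _ _ _ hone hb h.param_le_sum)
    · rw [hwt]
      rw [hσ', Store.readSet_writeSet] at hdisj
      exact ((F.isNet _ _ _ hone hb h.param_le_sum).mul_sum_lt hone ht hdisj).le

theorem runs_double_checkWeight (h : Searching b pts H c σ) {j : ℕ} (hj : j < pts.length)
    (hrow : σ.reg uncoveredRow = j * n) (hH : ¬Disjoint pts[j] H)
    (hlight : (4 * c + 2 * b) * ∑ s ∈ pts[j], σ.readMult n (pts.length * n) s ≤
      ∑ s, σ.readMult n (pts.length * n) s) :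
    Runs F 𝒯 (.double ;; .checkWeight (startWeight b)) σ (n * 17 + 19) fun σ' =>
      (Searching b pts H c σ' ∧ σ.reg total < σ'.reg total) ∨ Searching b pts H (c + 1) σ' := by
  have hL : 0 < startWeight b := Nat.add_pos_left (by decide) _
  have hstep := h.reweighted.step (le_add_right (by have := h.one_le; omega)) hlight hH
  obtain ⟨s, hst, hsH⟩ := Finset.not_disjoint_iff.mp hH
  refine ((runs_double h.isSetUp hj hrow).seq fun σ₁ hframe ⟨hset, htotal, hwt⟩ =>
    (runs_checkWeight hset).mono le_rfl fun σ₂ _ ⟨hset', hcase⟩ => ?_).of_le (by omega)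
  rw [← hwt] at hstep
  have hparam : σ₁.reg param = 4 * c + 2 * b := by rw [hframe.reg _ (by decide), h.param_eq]
  have htotal' : σ₁.reg total = ∑ s, σ₁.readMult n (pts.length * n) s := by
    rw [htotal, h.total_eq, hwt, sum_ite_mem_two_mul]
  obtain ⟨hle, hparam', hsame, hmem⟩ | ⟨hlt, hparam', hreset, hwt'⟩ := hcase
  · have hwt' : σ₂.readMult n (pts.length * n) = σ₁.readMult n (pts.length * n) :=
      funext fun s => congrFun hmem _
    refine .inl ⟨⟨hset', hparam'.trans hparam, by rw [hsame, hwt', htotal'], hsame.trans_le hle,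
      h.one_le, h.le_card, hwt' ▸ hstep⟩, ?_⟩
    rw [hsame, htotal]
    exact Nat.lt_add_of_pos_right <| (h.reweighted.pos hL s).trans_le <|
      Finset.single_le_sum (fun _ _ => Nat.zero_le _) hst
  · refine .inr (.start hset' (by omega) hreset hwt' (by omega) (h.le_card.lt_of_ne ?_))
    rintro rfl
    refine hlt.not_ge ((htotal'.trans_le (hstep.le_mul_sq hL ⟨s, hsH⟩ (by omega))).trans_eq ?_)
    rw [Fintype.card_fin]

theorem runs_reweight (h : Searching b pts H c σ) (hM : C.Lists M pts) (hH : C.IsCover M H) :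
    Runs F (F.TimeBounds (startWeight b * H.card) (startWeight b * (n * n)))
      (.reweight (startWeight b)) σ (pts.length * (n * 9 + 15) + n * 18 + 27) fun σ' =>
      (σ'.reg uncovered = 0 ∧ C.IsNetSizeCover b A M H.card (σ'.output n)) ∨
      (σ'.reg uncovered ≠ 0 ∧
        ((Searching b pts H c σ' ∧ σ.reg total < σ'.reg total) ∨
          Searching b pts H (c + 1) σ')) := by
  refine (h.runs_net.seq fun σ₁ hframe ⟨h₁, hcard, hnet⟩ =>
    (runs_scan h₁.isSetUp).seq fun σ₂ hframe' hscan =>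
    Runs.ifThen (B := n * 17 + 18) (fun hx => ?_) fun hx => ?_).of_le (by omega)
  all_goals
    have hmem : σ₂.mem = σ₁.mem := hframe'.mem (by simpa [Com.scan, Com.move, Com.ReadOnly]
      using readOnly_scanRow)
    have h₂ : Searching b pts H c σ₂ := h₁.of_frame hframe' (by decide) fun _ _ => by rw [hmem]
  · obtain ⟨j, hj, hrow, hdisj⟩ := (hscan.resolve_left fun h => hx h.1).2
    obtain ⟨p, -, hp⟩ := (hM.2 _).mp (List.getElem_mem hj)
    have htotal : σ₂.reg total = σ.reg total := by
      rw [hframe'.reg _ (by decide), hframe.reg _ (by decide)]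
    have hwt : σ₂.readMult n (pts.length * n) = σ₁.readMult n (pts.length * n) :=
      funext fun s => congrFun hmem _
    refine (h₂.runs_double_checkWeight hj hrow ((hM.isCover_iff.mp hH) _ (List.getElem_mem hj))
      (hwt ▸ hnet p _ hp hdisj)).mono (by omega) fun σ₃ hframe'' h₃ => .inr ⟨?_, htotal ▸ h₃⟩
    rwa [hframe''.reg _ (by simp [Com.double, Com.checkWeight, Com.resetWeights,
      Com.forCols, Com.colsLoop, Com.doubleCell, Com.ifThen, Com.move, Com.regs])]
  · obtain ⟨-, hcover⟩ := hscan.resolve_right fun h => by omega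
    have hout : σ₂.output n = σ₁.readSet n (pts.length * n + n) := by
      rw [← h₂.isSetUp.net, Store.output, Store.readSet, Store.readSet, hmem]
    refine .inl ⟨hx, ?_, _, h.param_le, ?_⟩
    · rw [hout]
      exact hM.isCover_iff.mpr hcover
    · rw [hout]
      exact hcard.trans (mul_le_mul_of_nonneg_right (le_abs_self A) (by positivity))

end Searching

/-- A bound for the running time of `Com.cover` for `l` points and `n` objects. -/
def coverTime {R : Type*} [CommSemiring R] (L l n : R) : R :=
  l * 3 + n * 3 + L * 3 + 13 +
    (n * 7 + 10 + (n * (L * (n * n) + 1) * (l * (n * 9 + 15) + n * 18 + 28) + 1) + 1)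

theorem Searching.runs_loop (h : Searching b pts H c σ) (hM : C.Lists M pts) (hH : C.IsCover M H)
    (huncovered : σ.reg uncovered ≠ 0) :
    Runs F (F.TimeBounds (startWeight b * H.card) (startWeight b * (n * n)))
      (.whilenz uncovered (.reweight (startWeight b))) σ
      (n * (startWeight b * (n * n) + 1) * (pts.length * (n * 9 + 15) + n * 18 + 28) + 1)
      fun σ' => C.IsNetSizeCover b A M H.card (σ'.output n) := by
  refine (Runs.whilenz (B := pts.length * (n * 9 + 15) + n * 18 + 27)
    (I := fun k σ' => (σ'.reg uncovered = 0 ∧ C.IsNetSizeCover b A M H.card (σ'.output n)) ∨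
      (σ'.reg uncovered ≠ 0 ∧ ∃ c', Searching b pts H c' σ' ∧
        (H.card - c') * (startWeight b * (n * n) + 1) +
          (startWeight b * (n * n) - σ'.reg total) < k))
    (fun k σ₁ _ hI hne => ?_) (.inr ⟨huncovered, c, h, ?_⟩)).mono le_rfl
    fun σ' _ ⟨hzero, k, _, hI⟩ => (hI.resolve_right fun h => h.1 hzero).2
  · obtain ⟨-, c₁, h₁, hk⟩ := hI.resolve_left fun h => hne h.1
    refine (h₁.runs_reweight hM hH).mono le_rfl fun σ₂ _ h₂ => ?_
    refine ⟨_, hk, ?_⟩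
    rcases h₂ with hdone | ⟨hne₂, ⟨h₂, htotal⟩ | h₂⟩
    · exact .inl hdone
    · have := h₂.total_le
      exact .inr ⟨hne₂, c₁, h₂, by omega⟩
    · have hsucc : H.card - c₁ = H.card - (c₁ + 1) + 1 := by have := h₂.le_card; omega
      refine .inr ⟨hne₂, c₁ + 1, h₂, ?_⟩
      rw [hsucc, add_mul]
      omega
  · have hcard : H.card - c + 1 ≤ n := by
      have := h.one_le
      have := h.le_card
      have := H.card_le_univ
      simp only [Fintype.card_fin] at this
      omega
    calc _ < (H.card - c) * (startWeight b * (n * n) + 1) + (startWeight b * (n * n) + 1) := by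
          omega
      _ = (H.card - c + 1) * (startWeight b * (n * n) + 1) := by ring
      _ ≤ n * (startWeight b * (n * n) + 1) := Nat.mul_le_mul_right _ hcard

theorem runs_cover (hM : C.Lists M pts) (hH : C.IsCover M H) :
    Runs F (F.TimeBounds (startWeight b * H.card) (startWeight b * (n * n)))
      (.cover b (startWeight b)) (Store.input pts) (coverTime (startWeight b) pts.length n)
      fun σ' => C.IsNetSizeCover b A M H.card (σ'.output n) := by
  refine (runs_setUp b (startWeight b) pts).seq
    fun σ _ ⟨hset, hparam, huncovered, hmem⟩ => Runs.ifThen (fun hne => ?_) fun hzero => ?_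
  · refine (runs_resetWeights hset).seq fun σ' hframe ⟨hset', hparam', htotal, hwt⟩ =>
      Searching.runs_loop (c := 1) (.start hset' (by rw [hparam', hparam, add_comm]) htotal hwt
        le_rfl ?_) hM hH ?_
    · obtain ⟨s, -, hs⟩ := Finset.not_disjoint_iff.mp <|
        hM.isCover_iff.mp hH _ (pts.getElem_mem (n := 0) (by omega))
      exact Finset.card_pos.mpr ⟨s, hs⟩
    · rwa [hframe.reg _ (by simp [Com.resetWeights, Com.forCols, Com.colsLoop, Com.move,
        Com.regs])]
  · obtain rfl : pts = [] := List.eq_nil_of_length_eq_zero (huncovered.symm.trans hzero)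
    have hout : σ.output n = ∅ := by
      ext s
      simp [Store.output, Store.mem_readSet, hmem, Store.input]
    refine ⟨hM.isCover_iff.mpr (by simp), 0, Nat.zero_le _, ?_⟩
    rw [hout, Finset.card_empty, Nat.cast_zero]
    positivity

end Cover

end GeomCover

open GeomCover in
theorem mainTheorem2 (b : ℕ) :
    -- nets of size `O(f(r))` exist, for all multisets of objects
    (∀ D : ℕ, ∃ A : ℝ, ∀ (U : Type u) (n : ℕ) (C : ConfigSystem.{u, 0, w} U (Fin n)),
      C.IsComplete → C.DefinedByAtMost b → C.DefinesAtMost D → Nonempty (NetFinder C b A)) ∧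
    -- one program turns any subroutine for such nets into a subroutine for covers
    (∃ P : Com, ∀ (D : ℕ) (A : ℝ), ∃ (K : ℝ) (Q : ℕ) (q : Polynomial ℕ),
      ∀ (U : Type u) (n : ℕ) (C : ConfigSystem.{u, 0, w} U (Fin n)),
      C.IsComplete → C.DefinedByAtMost b → C.DefinesAtMost D →
      ∀ (M : Set U) (pts : List (Finset (Fin n))), C.Lists M pts →
      ∀ (F : NetFinder C b A) (c : ℕ), (∃ H : Finset (Fin n), H.card = c ∧ C.IsCover M H) →
      ∃ (σ : Store) (t : ℕ), Exec F P (Store.input pts) σ t ∧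
        C.IsCover M (σ.output n) ∧
        ((σ.output n).card : ℝ) ≤ K * max 1 (C.f c) ∧
        ∀ T : ℕ,
          (∀ (j : ℕ) (m : Fin n → ℕ) (r : ℕ), 1 ≤ r → 2 * b ≤ r → r ≤ ∑ s, m s →
            r ≤ Q * c → ∑ s, m s ≤ q.eval n → F.cost j m r ≤ T) →
          t ≤ (T + 1) * q.eval n) := by
  refine ⟨fun D => ⟨netSize b D, fun U n C hC hb hD => nonempty_netFinder hC hb hD⟩,
    .cover b (startWeight b), fun D A => ?_⟩
  let q : Polynomial ℕ := coverTime (.C (startWeight b)) (.C D * (.X + 1) ^ b) .X +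
    .C (startWeight b) * (.X * .X)
  have hq : ∀ n, q.eval n = coverTime (startWeight b) (D * (n + 1) ^ b) n +
      startWeight b * (n * n) := fun n => by simp [q, coverTime]
  refine ⟨|A| * ConfigSystem.growthFactor b D (startWeight b), startWeight b, q, ?_⟩
  rintro U n C hC hb hD M pts hM F c ⟨H, rfl, hH⟩
  obtain ⟨σ, t, hexec, htime, hcover⟩ := runs_cover (F := F) hM hH
  refine ⟨σ, t, hexec, hcover.1, hcover.card_le hb hD, fun T hT => (htime T ?_).trans ?_⟩
  · exact fun j m r h₁ h₂ h₃ h₄ h₅ => hT j m r h₁ h₂ h₃ h₄ (h₅.trans (hq n ▸ Nat.le_add_left _ _))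
  · rw [hq]
    have hlen := hM.length_le hC hb hD
    exact Nat.mul_le_mul_left _ (le_add_right (by unfold coverTime; gcongr))
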